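/- **Setting.** Let $\mathscr G$ be an ample groupoid: a topological groupoid (not necessarily Hausdorff) whose unit space $\mathscr G^{(0)}$ is locally compact and Hausdorff with a basis of compact open sets and whose range map $r$ is a local homeomorphism; $d$ denotes the domain (source) map. A $\mathscr G$-sheaf of unital rings $\mathcal O=(E,p,\alpha)$ is a local homeomorphism $p\colon E\to\mathscr G^{(0)}$ with a unital ring structure on each stalk $\mathcal O_x=p^{-1}(x)$ such that the fibrewise addition and multiplication and the unit section $x\mapsto 1_x$ are continuous, together with a continuous action $\mathscr G\times_{d,p}E\to E$, $(\gamma,e)\mapsto\alpha_\gamma(e)$, of the groupoid by ring homomorphisms $\alpha_\gamma\colon\mathcal O_{d(\gamma)}\to\mathcal O_{r(\gamma)}$ (units act as identities, and $\alpha_\beta\alpha_\gamma=\alpha_{\beta\gamma}$). It is a $\mathscr G$-sheaf of fields if every stalk is a field. The ring $\Gamma_c(\mathscr G,\mathcal O)$ is the additive group generated by all maps $f\colon\mathscr G\to E$ with $f(\gamma)\in\mathcal O_{r(\gamma)}$ for which there is a compact open bisection $U$ such that $f|_U$ is continuous and $f$ vanishes off $U$; its product is the convolution $(f*g)(\gamma)=\sum_{\beta\rho=\gamma}f(\beta)\,\alpha_\beta(g(\rho))$.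 In general it has no unit. Its subring $\Gamma_c(\mathscr G^{(0)},\mathcal O)$ is generated additively by those maps $f$ for which $U$ can be chosen inside $\mathscr G^{(0)}$. A ring (possibly without unit) is semiprimitive if its Jacobson radical, the intersection of the annihilators of all simple left modules, is zero; a simple module $M$ over $R$ is one with $RM\neq 0$ whose only submodules are $0$ and $M$, and a semisimple module is a sum of simple submodules. For $x\in\mathscr G^{(0)}$ let $\mathscr G_x^x$ be the isotropy group at $x$ and let $B_x=\mathcal O_x\rtimes\mathscr G_x^x$ be the skew group ring, with $a\delta\cdot b\eta=a\,\alpha_\delta(b)\,\delta\eta$. Let $\mathcal L_x=\bigoplus_{d(\gamma)=x}\mathcal O_{r(\gamma)}1_\gamma$; it is a $\Gamma_c(\mathscr G,\mathcal O)$-$B_x$-bimodule via $f\cdot a1_\gamma=\sum_{d(\beta)=r(\gamma)}f(\beta)\alpha_\beta(a)1_{\beta\gamma}$ and $a1_\gamma\cdot b\delta=a\,\alpha_\gamma(b)1_{\gamma\delta}$. For a left $B_x$-module $M$ put $\mathrm{Ind}_x(M)=\mathcal L_x\otimes_{B_x}M$, a left $\Gamma_c(\mathscr G,\mathcal O)$-module.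 **Theorem.** Let $\mathscr G$ be an ample groupoid and $\mathcal O$ a $\mathscr G$-sheaf of fields such that $\Gamma_c(\mathscr G^{(0)},\mathcal O)$ is a maximal commutative subring of $\Gamma_c(\mathscr G,\mathcal O)$. Then $\Gamma_c(\mathscr G,\mathcal O)$ is semiprimitive. Moreover, for every choice of a simple left $B_x$-module $M_x$ for each $x\in\mathscr G^{(0)}$, the module $\bigoplus_{x\in\mathscr G^{(0)}}\mathrm{Ind}_x(M_x)$ is a faithful semisimple left $\Gamma_c(\mathscr G,\mathcal O)$-module. -/

import Mathlib

open CategoryTheory DirectSum TensorProduct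

universe u v w t

namespace SheafAlgebra

/-! ### Ample groupoids

A groupoid is Mathlib's `CategoryTheory.Groupoid`: the type of objects `X` plays the role of the
unit space and `Arr X` that of the arrow space.  For an arrow `γ : x ⟶ y` the domain is `x` and
the range is `y`; the product `βγ` of algebraists (first `γ`, then `β`) is `γ ≫ β`. -/

/-- The space of all arrows; `γ.left` is the domain and `γ.right` the range of `γ`. -/
abbrev Arr (X : Type u) [Groupoid.{v} X] : Type (max u v) := Quiver.Total X

/-- The fibre of the domain map over `x`: all arrows with domain `x`. -/
abbrev Out {X : Type u} [Groupoid.{v} X] (x : X) : Type (max u v) := Σ y : X, (x ⟶ y)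

/-- An arrow with domain `x`, as an element of the arrow space. -/
abbrev Out.arr {X : Type u} [Groupoid.{v} X] {x : X} (ρ : Out x) : Arr X := ⟨x, ρ.1, ρ.2⟩

/-- Pairs of composable arrows. -/
structure ComposablePair (X : Type u) [Groupoid.{v} X] where
  {dom : X}
  {mid : X}
  {cod : X}
  first : dom ⟶ mid
  second : mid ⟶ cod

/-- Composable pairs carry the subspace topology of the product of two copies of the arrow
space. -/
instance (X : Type u) [Groupoid.{v} X] [TopologicalSpace (Arr X)] :
    TopologicalSpace (ComposablePair X) :=
  TopologicalSpace.induced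
    (fun p => ((⟨p.dom, p.mid, p.first⟩ : Arr X), (⟨p.mid, p.cod, p.second⟩ : Arr X)))
    inferInstance

/-- Ample groupoids: étale topological groupoids (with locally compact Hausdorff unit space)
whose unit space has a basis of compact open sets.  The arrow space need not be Hausdorff. -/
class IsAmpleGroupoid (X : Type u) [Groupoid.{v} X] [TopologicalSpace X]
    [TopologicalSpace (Arr X)] : Prop where
  continuous_dom : Continuous (fun γ : Arr X => γ.left)
  continuous_unit : Continuous (fun x : X => (⟨x, x, 𝟙 x⟩ : Arr X))
  continuous_comp : Continuous
    (fun p : ComposablePair X => (⟨p.dom, p.cod, p.first ≫ p.second⟩ : Arr X))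
  continuous_inv : Continuous
    (fun γ : Arr X => (⟨γ.right, γ.left, Groupoid.inv γ.hom⟩ : Arr X))
  t2 : T2Space X
  locallyCompact : LocallyCompactSpace X
  isLocalHomeomorph_range : IsLocalHomeomorph (fun γ : Arr X => γ.right)
  isTopologicalBasis_compactOpen :
    TopologicalSpace.IsTopologicalBasis {U : Set X | IsOpen U ∧ IsCompact U}

/-- The set of unit arrows. -/
def unitArrows (X : Type u) [Groupoid.{v} X] : Set (Arr X) :=
  Set.range (fun x : X => (⟨x, x, 𝟙 x⟩ : Arr X))

/-- Compact open bisections.  (A compact set on which the continuous domain map into the Hausdorff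
unit space is injective is automatically Hausdorff.) -/
structure IsCompactOpenBisection {X : Type u} [Groupoid.{v} X] [TopologicalSpace (Arr X)]
    (U : Set (Arr X)) : Prop where
  isOpen : IsOpen U
  isCompact : IsCompact U
  injOn_dom : Set.InjOn (fun γ : Arr X => γ.left) U
  injOn_range : Set.InjOn (fun γ : Arr X => γ.right) U

/-! ### Sheaves of rings over a groupoid -/

/-- Pairs of points in a common stalk, i.e. the pullback `E ×_{p,p} E`. -/
structure FibrePair {X : Type u} (S : X → Type w) where
  {pt : X}
  fst : S pt
  snd : S pt

instance {X : Type u} (S : X → Type w) [TopologicalSpace (Σ x, S x)] :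
    TopologicalSpace (FibrePair S) :=
  TopologicalSpace.induced
    (fun p => ((⟨p.pt, p.fst⟩ : Σ x, S x), (⟨p.pt, p.snd⟩ : Σ x, S x))) inferInstance

/-- An arrow together with a point in the stalk over its domain, i.e. the pullback
`𝒢 ×_{d,p} E`. -/
structure ActPair {X : Type u} [Groupoid.{v} X] (S : X → Type w) where
  {dom : X}
  {cod : X}
  arrow : dom ⟶ cod
  val : S dom

instance {X : Type u} [Groupoid.{v} X] (S : X → Type w) [TopologicalSpace (Arr X)]
    [TopologicalSpace (Σ x, S x)] : TopologicalSpace (ActPair S) :=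
  TopologicalSpace.induced
    (fun p => ((⟨p.dom, p.cod, p.arrow⟩ : Arr X), (⟨p.dom, p.val⟩ : Σ x, S x))) inferInstance

/-- A `𝒢`-sheaf of unital rings, as an étale space `E = Σ x, stalk x` over the unit space with a
continuous action of the groupoid by ring homomorphisms between the stalks. -/
structure GSheafOfRings (X : Type u) [Groupoid.{v} X] [TopologicalSpace X]
    [TopologicalSpace (Arr X)] where
  stalk : X → Type w
  [ring : ∀ x, Ring (stalk x)]
  [topology : TopologicalSpace (Σ x, stalk x)]
  isLocalHomeomorph_proj : IsLocalHomeomorph (fun e : Σ x, stalk x => e.1)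
  continuous_add : Continuous
    (fun p : FibrePair stalk => (⟨p.pt, p.fst + p.snd⟩ : Σ x, stalk x))
  continuous_mul : Continuous
    (fun p : FibrePair stalk => (⟨p.pt, p.fst * p.snd⟩ : Σ x, stalk x))
  continuous_one : Continuous (fun x : X => (⟨x, 1⟩ : Σ x, stalk x))
  act : ∀ {x y : X}, (x ⟶ y) → (stalk x →+* stalk y)
  act_id : ∀ (x : X) (a : stalk x), act (𝟙 x) a = a
  act_comp : ∀ {x y z : X} (γ : x ⟶ y) (β : y ⟶ z) (a : stalk x),
    act (γ ≫ β) a = act β (act γ a)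
  continuous_act : Continuous
    (fun p : ActPair stalk => (⟨p.cod, act p.arrow p.val⟩ : Σ x, stalk x))

attribute [instance] GSheafOfRings.ring GSheafOfRings.topology

/-- A sheaf of fields: every stalk is a field. -/
def GSheafOfRings.IsSheafOfFields {X : Type u} [Groupoid.{v} X] [TopologicalSpace X]
    [TopologicalSpace (Arr X)] (𝒪 : GSheafOfRings.{u, v, w} X) : Prop :=
  ∀ x : X, IsField (𝒪.stalk x)

section Convolution

variable {X : Type u} [Groupoid.{v} X] [TopologicalSpace X] [TopologicalSpace (Arr X)]
  (𝒪 : GSheafOfRings.{u, v, w} X)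

/-- All (not necessarily continuous) maps `f` from the arrows to the étale space with
`p ∘ f = r`. -/
abbrev Sections : Type (max u v w) := ∀ γ : Arr X, 𝒪.stalk γ.right

variable {𝒪}

/-- A section as a map into the étale space. -/
def toSpace (f : Sections 𝒪) (γ : Arr X) : Σ x, 𝒪.stalk x := ⟨γ.right, f γ⟩

/-- `f` is continuous on `U` and vanishes off `U`. -/
def SupportedOn (f : Sections 𝒪) (U : Set (Arr X)) : Prop :=
  ContinuousOn (toSpace f) U ∧ ∀ γ, γ ∉ U → f γ = 0

/-- The convolution `(f * g)(γ) = ∑_{βρ = γ} f(β) α_β(g(ρ))`; the factorizations `γ = βρ` are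
parametrized by the arrow `ρ` with the same domain as `γ`, and then `β = γρ⁻¹`. -/
noncomputable def conv (f g : Sections 𝒪) : Sections 𝒪 := fun γ =>
  ∑ᶠ ρ : Out γ.left, f ⟨ρ.1, γ.right, Groupoid.inv ρ.2 ≫ γ.hom⟩ *
    𝒪.act (Groupoid.inv ρ.2 ≫ γ.hom) (g ρ.arr)

variable (𝒪)

/-- The additive group `Γ_c(𝒢, 𝒪)`: it is generated by the sections that are supported on a
compact open bisection. -/
def gammaSubgroup : AddSubgroup (Sections 𝒪) :=
  AddSubgroup.closure {f | ∃ U : Set (Arr X), IsCompactOpenBisection U ∧ SupportedOn f U}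

/-- The additive group `Γ_c(𝒢⁽⁰⁾, 𝒪)`, extended by zero to all arrows: it is generated by the
sections that are supported on a compact open subset of the unit space. -/
def gammaUnitSubgroup : AddSubgroup (Sections 𝒪) :=
  AddSubgroup.closure {f | ∃ U : Set (Arr X), U ⊆ unitArrows X ∧ IsCompactOpenBisection U ∧
    SupportedOn f U}

theorem gammaUnitSubgroup_le : gammaUnitSubgroup 𝒪 ≤ gammaSubgroup 𝒪 :=
  AddSubgroup.closure_mono fun _ ⟨U, _, hU, hf⟩ => ⟨U, hU, hf⟩

/-- The underlying type of `Γ_c(𝒢, 𝒪)`. -/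
def Gamma : Type (max u v w) := gammaSubgroup 𝒪

noncomputable instance : AddCommGroup (Gamma 𝒪) :=
  inferInstanceAs (AddCommGroup (gammaSubgroup 𝒪))

variable {𝒪}

theorem Out.arr_injective {x : X} : Function.Injective (Out.arr : Out x → Arr X) := by
  rintro ⟨y, γ⟩ ⟨z, β⟩ h
  simp only [Out.arr, Quiver.Total.mk.injEq, true_and] at h
  obtain ⟨rfl, h⟩ := h
  simp only [heq_eq_eq] at h
  rw [h]

/-- A section in `Γ_c(𝒢, 𝒪)` has only finitely many non-zero values on a fibre of the domain
map. -/
theorem finite_support {f : Sections 𝒪} (hf : f ∈ gammaSubgroup 𝒪) (x : X) :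
    {ρ : Out x | f ρ.arr ≠ 0}.Finite := by
  induction hf using AddSubgroup.closure_induction with
  | mem f hf =>
    obtain ⟨U, hU, -, h0⟩ := hf
    apply Set.Subsingleton.finite
    intro ρ hρ σ hσ
    apply Out.arr_injective
    have h1 : ρ.arr ∈ U := by by_contra h; exact hρ (h0 _ h)
    have h2 : σ.arr ∈ U := by by_contra h; exact hσ (h0 _ h)
    exact hU.injOn_dom h1 h2 rfl
  | zero => simp
  | add f g _ _ hf hg =>
    refine (hf.union hg).subset fun ρ hρ => ?_
    by_contra h
    simp only [Set.mem_union, Set.mem_ofPred_eq, not_or, not_not] at h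
    exact hρ (by simp [h.1, h.2])
  | neg f _ hf => simpa using hf

/-- The abelian group `𝓛_x`, the direct sum of the stalks `𝒪_{r(γ)}` over the arrows `γ` with
domain `x`; the element `a 1_γ` is `DirectSum.of _ γ a`. -/
abbrev Ell (𝒪 : GSheafOfRings.{u, v, w} X) (x : X) : Type (max u v w) :=
  ⨁ γ : Out x, 𝒪.stalk γ.1

open Classical in
/-- The restriction of an element of `Γ_c(𝒢, 𝒪)` to the fibre of the domain map over `x`. -/
noncomputable def res (x : X) : Gamma 𝒪 →+ Ell 𝒪 x where
  toFun f := DirectSum.mk (fun γ : Out x => 𝒪.stalk γ.1) (finite_support f.2 x).toFinset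
    fun ρ => f.1 ρ.1.arr
  map_zero' := by
    ext ρ
    by_cases h : ρ ∈ (finite_support (0 : Gamma 𝒪).2 x).toFinset
    · rw [DirectSum.mk_apply_of_mem h]; rfl
    · rw [DirectSum.mk_apply_of_notMem h]; rfl
  map_add' f g := by
    have key : ∀ (f : Gamma 𝒪) (ρ : Out x), DirectSum.mk (fun γ : Out x => 𝒪.stalk γ.1)
        (finite_support f.2 x).toFinset (fun ρ => f.1 ρ.1.arr) ρ = f.1 ρ.arr := by
      intro f ρ
      by_cases h : ρ ∈ (finite_support f.2 x).toFinset
      · rw [DirectSum.mk_apply_of_mem h]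
      · rw [DirectSum.mk_apply_of_notMem h]
        simp only [Set.Finite.mem_toFinset, Set.mem_ofPred_eq, not_not] at h
        exact h.symm
    ext ρ
    rw [DirectSum.add_apply, key, key, key]
    rfl

theorem res_apply (x : X) (f : Gamma 𝒪) (ρ : Out x) : res x f ρ = f.1 ρ.arr := by
  classical
  change DirectSum.mk (fun γ : Out x => 𝒪.stalk γ.1)
        (finite_support f.2 x).toFinset (fun ρ => f.1 ρ.1.arr) ρ = f.1 ρ.arr
  by_cases h : ρ ∈ (finite_support f.2 x).toFinset
  · rw [DirectSum.mk_apply_of_mem h]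
  · rw [DirectSum.mk_apply_of_notMem h]
    simp only [Set.Finite.mem_toFinset, Set.mem_ofPred_eq, not_not] at h
    exact h.symm

theorem Gamma.ext_res {f g : Gamma 𝒪} (h : ∀ x, res x f = res x g) : f = g := by
  apply Subtype.ext
  funext ⟨x, y, γ⟩
  have := congrArg (fun ξ : Ell 𝒪 x => ξ ⟨y, γ⟩) (h x)
  simpa only [res_apply] using this

open Classical in
/-- For `γ : x ⟶ y`, the biadditive map sending `∑ b_β 1_β ∈ 𝓛_y` and `a ∈ 𝒪_y` to
`∑ b_β α_β(a) 1_{βγ} ∈ 𝓛_x`. -/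
noncomputable def shift {x y : X} (γ : x ⟶ y) : Ell 𝒪 y →+ 𝒪.stalk y →+ Ell 𝒪 x :=
  DirectSum.toAddMonoid fun β : Out y =>
    { toFun := fun b => (DirectSum.of (fun γ : Out x => 𝒪.stalk γ.1) ⟨β.1, γ ≫ β.2⟩).comp
        ((AddMonoidHom.mulLeft b).comp (𝒪.act β.2).toAddMonoidHom)
      map_zero' := by ext a : 1; simp
      map_add' := fun b c => by ext a : 1; simp [add_mul] }

open Classical in
theorem shift_of {x y : X} (γ : x ⟶ y) (β : Out y) (b : 𝒪.stalk β.1) (a : 𝒪.stalk y) :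
    shift γ (DirectSum.of (fun γ : Out y => 𝒪.stalk γ.1) β b) a =
      DirectSum.of (fun γ : Out x => 𝒪.stalk γ.1) ⟨β.1, γ ≫ β.2⟩ (b * 𝒪.act β.2 a) := by
  simp [shift]

open Classical in
/-- The left action of `Γ_c(𝒢, 𝒪)` on `𝓛_x`, given by
`f • a 1_γ = ∑_{d(β) = r(γ)} f(β) α_β(a) 1_{βγ}`. -/
noncomputable def leftAct (x : X) : Gamma 𝒪 →+ Ell 𝒪 x →+ Ell 𝒪 x where
  toFun f := DirectSum.toAddMonoid fun γ : Out x => shift γ.2 (res γ.1 f)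
  map_zero' := by
    apply DirectSum.addHom_ext
    intro γ a
    simp
  map_add' f g := by
    apply DirectSum.addHom_ext
    intro γ a
    simp

open Classical in
theorem leftAct_of {x : X} (f : Gamma 𝒪) (γ : Out x) (a : 𝒪.stalk γ.1) :
    leftAct x f (DirectSum.of (fun γ : Out x => 𝒪.stalk γ.1) γ a) = shift γ.2 (res γ.1 f) a :=
  DirectSum.toAddMonoid_of _ _ _

open Classical in
theorem of_congr {x y : X} {γ β : x ⟶ y} (h : γ = β) (a : 𝒪.stalk y) :
    DirectSum.of (fun γ : Out x => 𝒪.stalk γ.1) ⟨y, γ⟩ a =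
      DirectSum.of (fun γ : Out x => 𝒪.stalk γ.1) ⟨y, β⟩ a := by
  rw [h]

theorem shift_shift {x y z : X} (γ : x ⟶ y) (β : y ⟶ z) (ξ : Ell 𝒪 z) (b : 𝒪.stalk z)
    (a : 𝒪.stalk y) :
    shift γ (shift β ξ b) a = shift (γ ≫ β) ξ (b * 𝒪.act β a) := by
  classical
  induction ξ using DirectSum.induction_on with
  | zero => simp
  | of δ c =>
    simp only [shift_of, 𝒪.act_comp, map_mul, mul_assoc]
    exact of_congr (Category.assoc _ _ _).symm _
  | add ξ η h1 h2 => simp only [map_add, AddMonoidHom.add_apply, h1, h2]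

theorem shift_leftAct {x y : X} (γ : x ⟶ y) (f : Gamma 𝒪) (ξ : Ell 𝒪 y) (a : 𝒪.stalk y) :
    shift γ (leftAct y f ξ) a = leftAct x f (shift γ ξ a) := by
  classical
  induction ξ using DirectSum.induction_on with
  | zero => simp
  | of δ c => rw [leftAct_of, shift_of, leftAct_of, shift_shift]
  | add ξ η h1 h2 => simp only [map_add, AddMonoidHom.add_apply, h1, h2]

theorem shift_apply {x y : X} (γ : x ⟶ y) (ξ : Ell 𝒪 y) (a : 𝒪.stalk y) (ζ : Out x) :
    shift γ ξ a ζ = ξ ⟨ζ.1, Groupoid.inv γ ≫ ζ.2⟩ * 𝒪.act (Groupoid.inv γ ≫ ζ.2) a := by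
  classical
  induction ξ using DirectSum.induction_on with
  | zero => simp
  | of δ c =>
    rw [shift_of]
    obtain ⟨z, δ⟩ := δ
    obtain ⟨z', ζ⟩ := ζ
    by_cases h : (⟨z', ζ⟩ : Out x) = ⟨z, γ ≫ δ⟩
    · obtain ⟨rfl, h⟩ := Sigma.mk.inj h
      obtain rfl := eq_of_heq h
      have h2 : Groupoid.inv γ ≫ γ ≫ δ = δ := by simp
      have h3 : ∀ ε : y ⟶ z', ε = δ → c * 𝒪.act δ a =
          DirectSum.of (fun γ : Out y => 𝒪.stalk γ.1) ⟨z', δ⟩ c ⟨z', ε⟩ * 𝒪.act ε a := by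
        rintro ε rfl
        rw [DirectSum.of_eq_same]
      rw [DirectSum.of_eq_same]
      exact h3 _ h2
    · rw [DirectSum.of_eq_of_ne _ _ _ h, DirectSum.of_eq_of_ne, zero_mul]
      intro h2
      apply h
      obtain ⟨rfl, h2⟩ := Sigma.mk.inj h2
      obtain rfl := eq_of_heq h2
      simp
  | add ξ η h1 h2 => simp only [map_add, AddMonoidHom.add_apply, DirectSum.add_apply, h1, h2, add_mul]

theorem leftAct_apply {x : X} (f : Gamma 𝒪) (ξ : Ell 𝒪 x) (ζ : Out x) :
    leftAct x f ξ ζ = ∑ᶠ ρ : Out x, f.1 ⟨ρ.1, ζ.1, Groupoid.inv ρ.2 ≫ ζ.2⟩ *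
      𝒪.act (Groupoid.inv ρ.2 ≫ ζ.2) (ξ ρ) := by
  classical
  have hfin : ∀ ξ : Ell 𝒪 x, (Function.support (M := 𝒪.stalk ζ.1) fun ρ : Out x =>
      (f.1 ⟨ρ.1, ζ.1, Groupoid.inv ρ.2 ≫ ζ.2⟩ *
        𝒪.act (Groupoid.inv ρ.2 ≫ ζ.2) (ξ ρ))).Finite := by
    intro ξ
    refine (DFinsupp.finite_support ξ).subset fun ρ hρ h => hρ ?_
    have h : ξ ρ = 0 := h
    simp [h]
  induction ξ using DirectSum.induction_on with
  | zero => simp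
  | of δ c =>
    rw [leftAct_of, shift_apply, finsum_eq_single _ δ, res_apply, DirectSum.of_eq_same]
    intro ρ hρ
    rw [DirectSum.of_eq_of_ne _ _ _ hρ]
    simp
  | add ξ η h1 h2 =>
    simp only [map_add, DirectSum.add_apply, mul_add, h1, h2]
    rw [← finsum_add_distrib (hfin ξ) (hfin η)]

end Convolution

/-! ### The convolution product is well defined -/

section Ring

variable {X : Type u} [Groupoid.{v} X] [TopologicalSpace X] [TopologicalSpace (Arr X)]
  {𝒪 : GSheafOfRings.{u, v, w} X}

/-- The product `UV` of two sets of arrows. -/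
def setMul (U V : Set (Arr X)) : Set (Arr X) :=
  {γ | ∃ ρ : Out γ.left, ρ.arr ∈ V ∧ (⟨ρ.1, γ.right, Groupoid.inv ρ.2 ≫ γ.hom⟩ : Arr X) ∈ U}

theorem conv_eq_of_mem {f g : Sections 𝒪} {V : Set (Arr X)} (hV : IsCompactOpenBisection V)
    (hg : SupportedOn g V) (γ : Arr X) (ρ : Out γ.left) (hρ : ρ.arr ∈ V) :
    conv f g γ = f ⟨ρ.1, γ.right, Groupoid.inv ρ.2 ≫ γ.hom⟩ *
      𝒪.act (Groupoid.inv ρ.2 ≫ γ.hom) (g ρ.arr) := by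
  apply finsum_eq_single
  intro σ hσ
  have : σ.arr ∉ V := fun h => hσ (Out.arr_injective (hV.injOn_dom h hρ rfl))
  rw [hg.2 _ this, map_zero, mul_zero]

theorem conv_eq_zero {f g : Sections 𝒪} {U V : Set (Arr X)}
    (hf : SupportedOn f U) (hg : SupportedOn g V) (γ : Arr X) (hγ : γ ∉ setMul U V) :
    conv f g γ = 0 := by
  apply finsum_eq_zero_of_forall_eq_zero
  intro ρ
  by_cases h : ρ.arr ∈ V
  · rw [hf.2 _ fun h' => hγ ⟨ρ, h, h'⟩, zero_mul]
  · rw [hg.2 _ h, map_zero, mul_zero]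

section Top

variable [IsAmpleGroupoid X]

theorem isOpenMap_dom : IsOpenMap (fun γ : Arr X => γ.left) := by
  have h : IsOpenMap (fun γ : Arr X => (⟨γ.right, γ.left, Groupoid.inv γ.hom⟩ : Arr X)) := by
    intro s hs
    have : (fun γ : Arr X => (⟨γ.right, γ.left, Groupoid.inv γ.hom⟩ : Arr X)) '' s =
        (fun γ : Arr X => (⟨γ.right, γ.left, Groupoid.inv γ.hom⟩ : Arr X)) ⁻¹' s :=
      congrFun (Set.image_eq_preimage_of_inverse (fun γ => by simp) (fun γ => by simp)) s
    rw [this]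
    exact hs.preimage IsAmpleGroupoid.continuous_inv
  exact (IsAmpleGroupoid.isLocalHomeomorph_range (X := X)).isOpenMap.comp h

/-- The domain of definition of the local section of the domain map given by `V`. -/
def liftDom (V : Set (Arr X)) : Set (Arr X) := {γ | ∃ ρ : Out γ.left, ρ.arr ∈ V}

theorem continuousOn_lift {V : Set (Arr X)} (hV : IsCompactOpenBisection V)
    (σ : ∀ γ : Arr X, Out γ.left) (hσ : ∀ γ ∈ liftDom V, (σ γ).arr ∈ V) :
    IsOpen (liftDom V) ∧ ContinuousOn (fun γ => (σ γ).arr) (liftDom V) := by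
  have key : ∀ W : Set (Arr X), (liftDom V ∩ (fun γ => (σ γ).arr) ⁻¹' W) =
      (fun γ : Arr X => γ.left) ⁻¹' ((fun γ : Arr X => γ.left) '' (V ∩ W)) := by
    intro W
    ext γ
    constructor
    · rintro ⟨h1, h2⟩
      exact ⟨(σ γ).arr, ⟨hσ γ h1, h2⟩, rfl⟩
    · rintro ⟨ρ, ⟨h1, h2⟩, h3⟩
      obtain ⟨x, y, ρ⟩ := ρ
      obtain ⟨x', z, γ⟩ := γ
      dsimp only at h3
      subst h3
      have hγ : (⟨x, z, γ⟩ : Arr X) ∈ liftDom V := ⟨⟨y, ρ⟩, h1⟩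
      refine ⟨hγ, ?_⟩
      have := hV.injOn_dom (hσ _ hγ) h1 rfl
      simp only [Set.mem_preimage]
      rw [this]
      exact h2
  have hop : ∀ W : Set (Arr X), IsOpen W →
      IsOpen (liftDom V ∩ (fun γ => (σ γ).arr) ⁻¹' W) := fun W hW => by
    rw [key]
    exact (isOpenMap_dom _ (hV.isOpen.inter hW)).preimage IsAmpleGroupoid.continuous_dom
  have h0 : IsOpen (liftDom V) := by simpa using hop Set.univ isOpen_univ
  refine ⟨h0, ?_⟩
  rw [continuousOn_open_iff h0]
  exact fun W hW => hop W hW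

theorem continuousOn_quot {D : Set (Arr X)} (σ : ∀ γ : Arr X, Out γ.left)
    (h : ContinuousOn (fun γ => (σ γ).arr) D) :
    ContinuousOn (fun γ : Arr X =>
      (⟨(σ γ).1, γ.right, Groupoid.inv (σ γ).2 ≫ γ.hom⟩ : Arr X)) D := by
  have h2 : ContinuousOn (fun γ : Arr X =>
      (⟨Groupoid.inv (σ γ).2, γ.hom⟩ : ComposablePair X)) D := by
    have hi : Topology.IsInducing (fun p : ComposablePair X =>
        ((⟨p.dom, p.mid, p.first⟩ : Arr X), (⟨p.mid, p.cod, p.second⟩ : Arr X))) := ⟨rfl⟩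
    rw [hi.continuousOn_iff]
    exact (IsAmpleGroupoid.continuous_inv.comp_continuousOn h).prodMk continuousOn_id
  exact IsAmpleGroupoid.continuous_comp.comp_continuousOn h2

theorem exists_lift (V : Set (Arr X)) :
    ∃ σ : ∀ γ : Arr X, Out γ.left, ∀ γ ∈ liftDom V, (σ γ).arr ∈ V := by
  classical
  refine ⟨fun γ => if h : ∃ ρ : Out γ.left, ρ.arr ∈ V then h.choose else ⟨γ.left, 𝟙 _⟩, ?_⟩
  intro γ hγ
  have h : ∃ ρ : Out γ.left, ρ.arr ∈ V := hγ
  simp only [h, dite_true]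
  exact h.choose_spec

theorem setMul_eq {U V : Set (Arr X)} (hV : IsCompactOpenBisection V)
    (σ : ∀ γ : Arr X, Out γ.left) (hσ : ∀ γ ∈ liftDom V, (σ γ).arr ∈ V) :
    setMul U V = liftDom V ∩ (fun γ : Arr X =>
      (⟨(σ γ).1, γ.right, Groupoid.inv (σ γ).2 ≫ γ.hom⟩ : Arr X)) ⁻¹' U := by
  ext γ
  constructor
  · rintro ⟨ρ, h1, h2⟩
    have hγ : γ ∈ liftDom V := ⟨ρ, h1⟩
    have : σ γ = ρ := Out.arr_injective (hV.injOn_dom (hσ _ hγ) h1 rfl)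
    refine ⟨hγ, ?_⟩
    change (⟨(σ γ).1, γ.right, Groupoid.inv (σ γ).2 ≫ γ.hom⟩ : Arr X) ∈ U
    rw [this]
    exact h2
  · rintro ⟨h1, h2⟩
    exact ⟨σ γ, hσ _ h1, h2⟩

theorem isCompactOpenBisection_setMul {U V : Set (Arr X)} (hU : IsCompactOpenBisection U)
    (hV : IsCompactOpenBisection V) : IsCompactOpenBisection (setMul U V) := by
  obtain ⟨σ, hσ⟩ := exists_lift V
  obtain ⟨hD, hc⟩ := continuousOn_lift hV σ hσ
  refine ⟨?_, ?_, ?_, ?_⟩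
  · rw [setMul_eq hV σ hσ]
    exact (continuousOn_quot σ hc).isOpen_inter_preimage hD hU.isOpen
  · have hi : Topology.IsInducing (fun p : ComposablePair X =>
        ((⟨p.dom, p.mid, p.first⟩ : Arr X), (⟨p.mid, p.cod, p.second⟩ : Arr X))) := ⟨rfl⟩
    have hT2 : T2Space X := IsAmpleGroupoid.t2
    have hK : IsCompact ((V ×ˢ U) ∩ {q : Arr X × Arr X | q.1.right = q.2.left}) := by
      refine (hV.isCompact.prod hU.isCompact).inter_right (isClosed_eq ?_ ?_)
      · exact (IsAmpleGroupoid.isLocalHomeomorph_range (X := X)).continuous.comp continuous_fst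
      · exact (IsAmpleGroupoid.continuous_dom (X := X)).comp continuous_snd
    rw [← hi.isCompact_preimage_iff] at hK
    · have := hK.image IsAmpleGroupoid.continuous_comp
      convert this using 1
      ext γ
      constructor
      · rintro ⟨ρ, h1, h2⟩
        exact ⟨⟨ρ.2, Groupoid.inv ρ.2 ≫ γ.hom⟩, ⟨⟨h1, h2⟩, rfl⟩, by simp⟩
      · rintro ⟨p, ⟨⟨h1, h2⟩, -⟩, rfl⟩
        refine ⟨⟨p.mid, p.first⟩, h1, ?_⟩
        simpa using h2
    · rintro ⟨⟨x, y, ρ⟩, ⟨y', z, β⟩⟩ ⟨-, h⟩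
      replace h : y = y' := h
      subst h
      exact ⟨⟨ρ, β⟩, rfl⟩
  · rintro ⟨x, z, γ⟩ ⟨⟨y, ρ⟩, h1, h2⟩ ⟨x', z', γ'⟩ ⟨⟨y', ρ'⟩, h1', h2'⟩ h
    dsimp only at h
    subst h
    obtain ⟨rfl, h⟩ := Sigma.mk.inj (Out.arr_injective (hV.injOn_dom h1 h1' rfl))
    obtain rfl := eq_of_heq h
    obtain ⟨rfl, h⟩ := Sigma.mk.inj (Out.arr_injective (x := y)
      (a₁ := ⟨z, Groupoid.inv ρ ≫ γ⟩) (a₂ := ⟨z', Groupoid.inv ρ ≫ γ'⟩)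
      (hU.injOn_dom h2 h2' rfl))
    have h := eq_of_heq h
    rw [cancel_epi] at h
    rw [h]
  · rintro ⟨x, z, γ⟩ ⟨⟨y, ρ⟩, h1, h2⟩ ⟨x', z', γ'⟩ ⟨⟨y', ρ'⟩, h1', h2'⟩ h
    dsimp only at h
    subst h
    have h3 := hU.injOn_range h2 h2' rfl
    have h4 : y = y' := congrArg Quiver.Total.left h3
    subst h4
    have h5 := hV.injOn_range h1 h1' rfl
    have h6 : x = x' := congrArg Quiver.Total.left h5
    subst h6
    simp only [Out.arr, Quiver.Total.mk.injEq, heq_eq_eq, true_and] at h3 h5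
    subst h5
    rw [cancel_epi] at h3
    rw [h3]

theorem supportedOn_conv {f g : Sections 𝒪} {U V : Set (Arr X)}
    (hV : IsCompactOpenBisection V)
    (hf : SupportedOn f U) (hg : SupportedOn g V) : SupportedOn (conv f g) (setMul U V) := by
  refine ⟨?_, fun γ hγ => conv_eq_zero hf hg γ hγ⟩
  obtain ⟨σ, hσ⟩ := exists_lift V
  obtain ⟨hD, hc⟩ := continuousOn_lift hV σ hσ
  have hq := continuousOn_quot σ hc
  have hsub : setMul U V ⊆ liftDom V := fun γ ⟨ρ, h, _⟩ => ⟨ρ, h⟩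
  have hmem : ∀ γ ∈ setMul U V,
      (⟨(σ γ).1, γ.right, Groupoid.inv (σ γ).2 ≫ γ.hom⟩ : Arr X) ∈ U := by
    intro γ hγ
    rw [setMul_eq hV σ hσ] at hγ
    exact hγ.2
  have hcf : ContinuousOn (fun γ : Arr X =>
      toSpace f ⟨(σ γ).1, γ.right, Groupoid.inv (σ γ).2 ≫ γ.hom⟩) (setMul U V) :=
    hf.1.comp (hq.mono hsub) hmem
  have hcg : ContinuousOn (fun γ : Arr X => toSpace g (σ γ).arr) (setMul U V) :=
    hg.1.comp (hc.mono hsub) fun γ hγ => hσ _ (hsub hγ)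
  have hca : ContinuousOn (fun γ : Arr X => (⟨γ.right, 𝒪.act (Groupoid.inv (σ γ).2 ≫ γ.hom)
      (g (σ γ).arr)⟩ : Σ x, 𝒪.stalk x)) (setMul U V) := by
    have : ContinuousOn (fun γ : Arr X => (⟨Groupoid.inv (σ γ).2 ≫ γ.hom, g (σ γ).arr⟩ :
        ActPair 𝒪.stalk)) (setMul U V) := by
      have hi : Topology.IsInducing (fun p : ActPair 𝒪.stalk =>
        ((⟨p.dom, p.cod, p.arrow⟩ : Arr X), (⟨p.dom, p.val⟩ : Σ x, 𝒪.stalk x))) := ⟨rfl⟩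
      rw [hi.continuousOn_iff]
      exact (hq.mono hsub).prodMk hcg
    exact 𝒪.continuous_act.comp_continuousOn this
  have hfin : ContinuousOn (fun γ : Arr X =>
      (⟨γ.right, f ⟨(σ γ).1, γ.right, Groupoid.inv (σ γ).2 ≫ γ.hom⟩ *
        𝒪.act (Groupoid.inv (σ γ).2 ≫ γ.hom) (g (σ γ).arr)⟩ : Σ x, 𝒪.stalk x))
      (setMul U V) := by
    have : ContinuousOn (fun γ : Arr X =>
        (⟨f ⟨(σ γ).1, γ.right, Groupoid.inv (σ γ).2 ≫ γ.hom⟩,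
          𝒪.act (Groupoid.inv (σ γ).2 ≫ γ.hom) (g (σ γ).arr)⟩ : FibrePair 𝒪.stalk))
        (setMul U V) := by
      have hi : Topology.IsInducing (fun p : FibrePair 𝒪.stalk =>
        ((⟨p.pt, p.fst⟩ : Σ x, 𝒪.stalk x), (⟨p.pt, p.snd⟩ : Σ x, 𝒪.stalk x))) := ⟨rfl⟩
      rw [hi.continuousOn_iff]
      exact hcf.prodMk hca
    exact 𝒪.continuous_mul.comp_continuousOn this
  refine hfin.congr fun γ hγ => ?_
  simp only [toSpace]
  rw [conv_eq_of_mem hV hg γ (σ γ) (hσ _ (hsub hγ))]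

theorem setMul_subset_unitArrows {U V : Set (Arr X)} (hU : U ⊆ unitArrows X)
    (hV : V ⊆ unitArrows X) : setMul U V ⊆ unitArrows X := by
  rintro ⟨x, z, γ⟩ ⟨⟨y, ρ⟩, h1, h2⟩
  obtain ⟨a, ha⟩ := hV h1
  obtain ⟨b, hb⟩ := hU h2
  simp only [Out.arr, Quiver.Total.mk.injEq] at ha hb
  obtain ⟨rfl, rfl, ha⟩ := ha
  obtain ⟨rfl, rfl, hb⟩ := hb
  obtain rfl := eq_of_heq ha
  refine ⟨b, ?_⟩
  have hb := eq_of_heq hb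
  rw [Groupoid.inv_eq_inv, IsIso.inv_id, Category.id_comp] at hb
  rw [← hb]

end Top

theorem conv_add_left {f₁ f₂ g : Sections 𝒪} (hg : g ∈ gammaSubgroup 𝒪) :
    conv (f₁ + f₂) g = conv f₁ g + conv f₂ g := by
  funext γ
  have hfin : ∀ f : Sections 𝒪, (Function.support (M := 𝒪.stalk γ.right) fun ρ : Out γ.left =>
      (f ⟨ρ.1, γ.right, Groupoid.inv ρ.2 ≫ γ.hom⟩ *
        𝒪.act (Groupoid.inv ρ.2 ≫ γ.hom) (g ρ.arr))).Finite := fun f =>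
    (finite_support hg γ.left).subset fun ρ hρ h => hρ (by simp [h])
  simp only [conv, Pi.add_apply, add_mul]
  exact finsum_add_distrib (hfin f₁) (hfin f₂)

theorem conv_add_right {f g₁ g₂ : Sections 𝒪} (hg₁ : g₁ ∈ gammaSubgroup 𝒪)
    (hg₂ : g₂ ∈ gammaSubgroup 𝒪) : conv f (g₁ + g₂) = conv f g₁ + conv f g₂ := by
  funext γ
  have hfin : ∀ g ∈ gammaSubgroup 𝒪, (Function.support (M := 𝒪.stalk γ.right) fun ρ : Out γ.left =>
      (f ⟨ρ.1, γ.right, Groupoid.inv ρ.2 ≫ γ.hom⟩ *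
        𝒪.act (Groupoid.inv ρ.2 ≫ γ.hom) (g ρ.arr))).Finite := fun g hg =>
    (finite_support hg γ.left).subset fun ρ hρ h => hρ (by simp [h])
  simp only [conv, Pi.add_apply, map_add, mul_add]
  exact finsum_add_distrib (hfin g₁ hg₁) (hfin g₂ hg₂)

theorem conv_zero_left (g : Sections 𝒪) : conv 0 g = 0 := by
  funext γ; simp [conv]

theorem conv_zero_right (f : Sections 𝒪) : conv f 0 = 0 := by
  funext γ; simp [conv]

theorem conv_neg_left (f g : Sections 𝒪) : conv (-f) g = -conv f g := by
  funext γ; simp [conv, finsum_neg_distrib]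

theorem conv_neg_right (f g : Sections 𝒪) : conv f (-g) = -conv f g := by
  funext γ; simp [conv, finsum_neg_distrib]

variable [IsAmpleGroupoid X]

theorem conv_mem {f g : Sections 𝒪} (hf : f ∈ gammaSubgroup 𝒪) (hg : g ∈ gammaSubgroup 𝒪) :
    conv f g ∈ gammaSubgroup 𝒪 := by
  induction hf using AddSubgroup.closure_induction with
  | mem f hf =>
    obtain ⟨U, hU, hfU⟩ := hf
    induction hg using AddSubgroup.closure_induction with
    | mem g hg =>
      obtain ⟨V, hV, hgV⟩ := hg
      exact AddSubgroup.subset_closure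
        ⟨_, isCompactOpenBisection_setMul hU hV, supportedOn_conv hV hfU hgV⟩
    | zero => rw [conv_zero_right]; exact zero_mem _
    | add g h hg hh h1 h2 => rw [conv_add_right hg hh]; exact add_mem h1 h2
    | neg g _ h => rw [conv_neg_right]; exact neg_mem h
  | zero => rw [conv_zero_left]; exact zero_mem _
  | add f h _ _ h1 h2 => rw [conv_add_left hg]; exact add_mem h1 h2
  | neg f _ h => rw [conv_neg_left]; exact neg_mem h

theorem conv_mem_unit {f g : Sections 𝒪} (hf : f ∈ gammaUnitSubgroup 𝒪)
    (hg : g ∈ gammaUnitSubgroup 𝒪) : conv f g ∈ gammaUnitSubgroup 𝒪 := by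
  induction hf using AddSubgroup.closure_induction with
  | mem f hf =>
    obtain ⟨U, hU₀, hU, hfU⟩ := hf
    induction hg using AddSubgroup.closure_induction with
    | mem g hg =>
      obtain ⟨V, hV₀, hV, hgV⟩ := hg
      exact AddSubgroup.subset_closure ⟨_, setMul_subset_unitArrows hU₀ hV₀,
        isCompactOpenBisection_setMul hU hV, supportedOn_conv hV hfU hgV⟩
    | zero => rw [conv_zero_right]; exact zero_mem _
    | add g h hg hh h1 h2 =>
      rw [conv_add_right (gammaUnitSubgroup_le 𝒪 hg) (gammaUnitSubgroup_le 𝒪 hh)]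
      exact add_mem h1 h2
    | neg g _ h => rw [conv_neg_right]; exact neg_mem h
  | zero => rw [conv_zero_left]; exact zero_mem _
  | add f h _ _ h1 h2 =>
    rw [conv_add_left (gammaUnitSubgroup_le 𝒪 hg)]; exact add_mem h1 h2
  | neg f _ h => rw [conv_neg_left]; exact neg_mem h

noncomputable instance : Mul (Gamma 𝒪) := ⟨fun f g => ⟨conv f.1 g.1, conv_mem f.2 g.2⟩⟩

theorem res_mul (x : X) (f g : Gamma 𝒪) : res x (f * g) = leftAct x f (res x g) := by
  ext ζ
  rw [res_apply, leftAct_apply]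
  simp only [res_apply]
  rfl

theorem leftAct_mul (x : X) (f g : Gamma 𝒪) :
    leftAct x (f * g) = (leftAct x f).comp (leftAct x g) := by
  classical
  apply DirectSum.addHom_ext
  intro γ a
  rw [AddMonoidHom.comp_apply, leftAct_of, leftAct_of, res_mul, shift_leftAct]

/-- The ring `Γ_c(𝒢, 𝒪)` under pointwise addition and convolution (in general without unit). -/
noncomputable instance : NonUnitalRing (Gamma 𝒪) where
  __ := (inferInstance : AddCommGroup (Gamma 𝒪))
  mul := (· * ·)
  left_distrib f g h := Subtype.ext (conv_add_right g.2 h.2)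
  right_distrib f g h := Subtype.ext (conv_add_left h.2)
  zero_mul f := Subtype.ext (conv_zero_left _)
  mul_zero f := Subtype.ext (conv_zero_right _)
  mul_assoc f g h := Gamma.ext_res fun x => by
    rw [res_mul, res_mul, res_mul, leftAct_mul]; rfl

variable (𝒪)

/-- The diagonal subring `Γ_c(𝒢⁽⁰⁾, 𝒪)` of `Γ_c(𝒢, 𝒪)`. -/
noncomputable def gammaUnit : NonUnitalSubring (Gamma 𝒪) where
  carrier := {f | f.1 ∈ gammaUnitSubgroup 𝒪}
  add_mem' := fun hf hg => (gammaUnitSubgroup 𝒪).add_mem hf hg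
  zero_mem' := zero_mem (gammaUnitSubgroup 𝒪)
  neg_mem' := fun hf => (gammaUnitSubgroup 𝒪).neg_mem hf
  mul_mem' := fun hf hg => conv_mem_unit hf hg

end Ring

/-! ### Modules over rings without unit -/

section Modules

/-- A subring is maximal commutative if it is maximal among the commutative subrings. -/
def IsMaximalCommutative {R : Type u} [NonUnitalRing R] (S : NonUnitalSubring R) : Prop :=
  Maximal (fun T : NonUnitalSubring R => ∀ a ∈ T, ∀ b ∈ T, a * b = b * a) S

variable {R : Type u} [NonUnitalRing R] {M : Type t} [AddCommGroup M]

/-! A left module over a ring `R` without unit is an abelian group `M` together with a ring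
homomorphism `ρ : R →ₙ+* AddMonoid.End M`; here `ρ r m` is `r • m`. -/

/-- Submodules: subgroups that are stable under the action. -/
def IsSubmodule (ρ : R →ₙ+* AddMonoid.End M) (N : AddSubgroup M) : Prop :=
  ∀ r : R, ∀ m ∈ N, ρ r m ∈ N

/-- The submodule `N` is simple: `RN ≠ 0` and `N` has no submodules other than `0` and `N`. -/
def IsSimpleSubmodule (ρ : R →ₙ+* AddMonoid.End M) (N : AddSubgroup M) : Prop :=
  IsSubmodule ρ N ∧ (∃ r : R, ∃ m ∈ N, ρ r m ≠ 0) ∧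
    ∀ K : AddSubgroup M, IsSubmodule ρ K → K ≤ N → K = ⊥ ∨ K = N

/-- Simple modules. -/
def IsSimple (ρ : R →ₙ+* AddMonoid.End M) : Prop := IsSimpleSubmodule ρ ⊤

/-- Semisimple modules: sums of simple submodules. -/
def IsSemisimple (ρ : R →ₙ+* AddMonoid.End M) : Prop :=
  sSup {N : AddSubgroup M | IsSimpleSubmodule ρ N} = ⊤

/-- Faithful modules: only `0` annihilates the module. -/
def IsFaithful (ρ : R →ₙ+* AddMonoid.End M) : Prop :=
  ∀ r : R, (∀ m : M, ρ r m = 0) → r = 0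

variable (R)

/-- The Jacobson radical of a ring that need not have a unit: the elements that annihilate every
simple left module.  (Up to isomorphism every simple module is a quotient of the additive group
of `R`, so that it suffices to look at the universe of `R`.) -/
def jacobsonRadical : Set R :=
  {a | ∀ (M : Type u) [AddCommGroup M] (ρ : R →ₙ+* AddMonoid.End M), IsSimple ρ →
    ∀ m : M, ρ a m = 0}

/-- A ring is semiprimitive if its Jacobson radical is zero. -/
def IsSemiprimitive : Prop := jacobsonRadical R = {0}

/-- The direct sum of a family of modules. -/
noncomputable def directSumModule {R : Type u} [NonUnitalRing R] {ι : Type v} {M : ι → Type t}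
    [∀ i, AddCommGroup (M i)] (ρ : ∀ i, R →ₙ+* AddMonoid.End (M i)) :
    R →ₙ+* AddMonoid.End (⨁ i, M i) where
  toFun r := DirectSum.map fun i => ρ i r
  map_zero' := by
    refine AddMonoidHom.ext fun m => DFinsupp.ext fun i => ?_
    refine (DirectSum.map_apply _ _ _).trans ?_
    rw [map_zero]; rfl
  map_add' r s := by
    refine AddMonoidHom.ext fun m => DFinsupp.ext fun i => ?_
    refine (DirectSum.map_apply _ _ _).trans ?_
    rw [map_add]; rfl
  map_mul' r s := by
    refine AddMonoidHom.ext fun m => DFinsupp.ext fun i => ?_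
    refine (DirectSum.map_apply _ _ _).trans ?_
    rw [map_mul]; rfl

end Modules

/-! ### Induced modules -/

section Induction

variable {X : Type u} [Groupoid.{v} X] [TopologicalSpace X] [TopologicalSpace (Arr X)]
  (𝒪 : GSheafOfRings.{u, v, w} X)

/-- The isotropy group at `x` acts on the stalk at `x`. In `End x` the product `β * γ` is
`γ ≫ β`. -/
instance isotropyAction (x : X) : MulSemiringAction (End x) (𝒪.stalk x) where
  smul γ a := 𝒪.act γ a
  one_smul a := 𝒪.act_id x a
  mul_smul β γ a := 𝒪.act_comp γ β a
  smul_zero γ := map_zero (𝒪.act γ)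
  smul_add γ := map_add (𝒪.act γ)
  smul_one γ := map_one (𝒪.act γ)
  smul_mul γ := map_mul (𝒪.act γ)

/-- The isotropy skew group ring `B_x = 𝒪_x ⋊ 𝒢_x^x`, in which `aδ · bη = a α_δ(b) δη`. -/
abbrev IsotropyRing (x : X) : Type (max v w) := SkewMonoidAlgebra (𝒪.stalk x) (End x)

variable {𝒪}

open Classical in
/-- The right action on `𝓛_x` of an element `bδ` of `B_x`: `a 1_γ · bδ = a α_γ(b) 1_{γδ}`. -/
noncomputable def rightActSingle (x : X) (δ : End x) :
    𝒪.stalk x →+ Ell 𝒪 x →+ Ell 𝒪 x where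
  toFun b := DirectSum.toAddMonoid fun γ : Out x =>
    (DirectSum.of (fun γ : Out x => 𝒪.stalk γ.1) ⟨γ.1, (show x ⟶ x from δ) ≫ γ.2⟩).comp
      (AddMonoidHom.mulRight (𝒪.act γ.2 b))
  map_zero' := by
    apply DirectSum.addHom_ext
    intro γ a
    simp
  map_add' b c := by
    apply DirectSum.addHom_ext
    intro γ a
    simp [mul_add]

/-- The right action of `B_x` on `𝓛_x`; `rightAct x b l` is `l · b`. -/
noncomputable def rightAct (x : X) : IsotropyRing 𝒪 x →+ Ell 𝒪 x →+ Ell 𝒪 x :=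
  (Finsupp.liftAddHom (rightActSingle x)).comp
    (SkewMonoidAlgebra.coeffAddEquiv (k := 𝒪.stalk x) (G := End x)).toAddMonoidHom

theorem rightAct_single (x : X) (δ : End x) (b : 𝒪.stalk x) :
    rightAct x (SkewMonoidAlgebra.single δ b) = rightActSingle x δ b := by
  simp [rightAct, SkewMonoidAlgebra.coeffAddEquiv]

open Classical in
theorem rightActSingle_of (x : X) (δ : End x) (b : 𝒪.stalk x) (γ : Out x) (a : 𝒪.stalk γ.1) :
    rightActSingle x δ b (DirectSum.of (fun γ : Out x => 𝒪.stalk γ.1) γ a) =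
      DirectSum.of (fun γ : Out x => 𝒪.stalk γ.1) ⟨γ.1, (show x ⟶ x from δ) ≫ γ.2⟩
        (a * 𝒪.act γ.2 b) :=
  DirectSum.toAddMonoid_of _ _ _

theorem rightActSingle_shift {x y : X} (δ : End x) (b : 𝒪.stalk x) (γ : x ⟶ y) (ξ : Ell 𝒪 y)
    (a : 𝒪.stalk y) :
    rightActSingle x δ b (shift γ ξ a) =
      shift ((show x ⟶ x from δ) ≫ γ) ξ (a * 𝒪.act γ b) := by
  classical
  induction ξ using DirectSum.induction_on with
  | zero => simp
  | of β c =>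
    rw [shift_of, shift_of, rightActSingle_of]
    simp only [𝒪.act_comp, map_mul, mul_assoc]
    exact of_congr (Category.assoc _ _ _).symm _
  | add ξ η h1 h2 => simp only [map_add, AddMonoidHom.add_apply, h1, h2]

/-- The left action of `Γ_c(𝒢, 𝒪)` on `𝓛_x` commutes with the right action of `B_x`. -/
theorem leftAct_rightAct (x : X) (f : Gamma 𝒪) (b : IsotropyRing 𝒪 x) (l : Ell 𝒪 x) :
    leftAct x f (rightAct x b l) = rightAct x b (leftAct x f l) := by
  classical
  induction b using SkewMonoidAlgebra.induction_on with
  | zero => simp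
  | single δ b =>
    rw [rightAct_single]
    induction l using DirectSum.induction_on with
    | zero => simp
    | of γ a => rw [rightActSingle_of, leftAct_of, leftAct_of, rightActSingle_shift]
    | add l m h1 h2 => simp only [map_add, h1, h2]
  | add b c h1 h2 => simp only [map_add, AddMonoidHom.add_apply, h1, h2]

variable (𝒪)

/-- The relations `l·b ⊗ m = l ⊗ b·m` that define `𝓛_x ⊗_{B_x} M` as a quotient of
`𝓛_x ⊗_ℤ M`. -/
def balanced (x : X) (M : Type t) [AddCommGroup M] [Module (IsotropyRing 𝒪 x) M] :
    AddSubgroup (Ell 𝒪 x ⊗[ℤ] M) :=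
  AddSubgroup.closure {z | ∃ (l : Ell 𝒪 x) (b : IsotropyRing 𝒪 x) (m : M),
    z = rightAct x b l ⊗ₜ[ℤ] m - l ⊗ₜ[ℤ] (b • m)}

/-- The abelian group `Ind_x(M) = 𝓛_x ⊗_{B_x} M`. -/
abbrev Ind (x : X) (M : Type t) [AddCommGroup M] [Module (IsotropyRing 𝒪 x) M] :
    Type (max u v w t) :=
  (Ell 𝒪 x ⊗[ℤ] M) ⧸ balanced 𝒪 x M

theorem balanced_le (x : X) (M : Type t) [AddCommGroup M] [Module (IsotropyRing 𝒪 x) M]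
    (f : Gamma 𝒪) : balanced 𝒪 x M ≤ (balanced 𝒪 x M).comap
      (LinearMap.rTensor M (AddMonoidHom.toIntLinearMap (leftAct x f))).toAddMonoidHom := by
  rw [balanced, AddSubgroup.closure_le]
  rintro _ ⟨l, b, m, rfl⟩
  apply AddSubgroup.subset_closure
  refine ⟨leftAct x f l, b, m, ?_⟩
  simp only [LinearMap.toAddMonoidHom_coe, map_sub, LinearMap.rTensor_tmul,
    AddMonoidHom.coe_toIntLinearMap, leftAct_rightAct]

variable [IsAmpleGroupoid X]

/-- The induced module: `Γ_c(𝒢, 𝒪)` acts on `Ind_x(M)` by `f • (l ⊗ m) = (f • l) ⊗ m`. -/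
noncomputable def indModule (x : X) (M : Type t) [AddCommGroup M]
    [Module (IsotropyRing 𝒪 x) M] : Gamma 𝒪 →ₙ+* AddMonoid.End (Ind 𝒪 x M) where
  toFun f := QuotientAddGroup.map _ _
    (LinearMap.rTensor M (AddMonoidHom.toIntLinearMap (leftAct x f))).toAddMonoidHom
    (balanced_le 𝒪 x M f)
  map_zero' := by
    apply QuotientAddGroup.addMonoidHom_ext
    ext z
    induction z using TensorProduct.induction_on with
    | zero => simp
    | tmul l m => simp; rfl
    | add z w h1 h2 =>
      exact (map_add _ z w).trans ((congrArg₂ _ h1 h2).trans (map_add _ z w).symm)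
  map_add' f g := by
    apply QuotientAddGroup.addMonoidHom_ext
    ext z
    induction z using TensorProduct.induction_on with
    | zero => simp
    | tmul l m => simp [TensorProduct.add_tmul]; rfl
    | add z w h1 h2 =>
      exact (map_add _ z w).trans ((congrArg₂ _ h1 h2).trans (map_add _ z w).symm)
  map_mul' f g := by
    apply QuotientAddGroup.addMonoidHom_ext
    ext z
    induction z using TensorProduct.induction_on with
    | zero => simp
    | tmul l m => simp [leftAct_mul]; rfl
    | add z w h1 h2 =>
      exact (map_add _ z w).trans ((congrArg₂ _ h1 h2).trans (map_add _ z w).symm)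

end Induction

end SheafAlgebra

/-!
The key fact is that every nonzero two-sided ideal `I` of `Γ_c(𝒢, 𝒪)` contains a nonzero diagonal
element, that is, one of `Γ_c(𝒢⁽⁰⁾, 𝒪)`. Suppose that `I` does not, and write an element of `I` as a
sum of `n` sections supported on compact open bisections. If the sum is nonzero, some right multiple
of it is still nonzero but has a diagonal summand. The commutator of this multiple with any diagonal
element lies in `I` and is a sum of `n - 1` sections on bisections, so it vanishes by induction on
`n`. By maximal commutativity the multiple is itself diagonal, which is a contradiction.

A diagonal section `f` acts on `1_x ⊗ m` in `Ind_x(M)` through the scalar `f(x)`. Hence, if `f`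
annihilates enough induced modules, all its values annihilate the modules `M` from which these are
induced. Over a sheaf of fields this forces `f = 0` as soon as there is a nonzero `M` for each `x`.
If all simple `B_x`-modules are used, then it suffices that the stalks have zero Jacobson radical,
because the Jacobson radical of `B_x` meets `𝒪_x` inside that of `𝒪_x`.

For the simplicity of `Ind_x(M)`, note that diagonal sections separate the finitely many ranges
that occur in an element of `Ind_x(M)`. So a nonzero submodule `N` contains a nonzero `1_γ ⊗ m`, and
then all of `𝓛_x ⊗ m`. The elements `m` with `𝓛_x ⊗ m ⊆ N` form a `B_x`-submodule of `M`.
-/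

namespace SheafAlgebra

section Stalkwise

variable {X : Type u} [Groupoid.{v} X] [TopologicalSpace X] [TopologicalSpace (Arr X)]
  {𝒪 : GSheafOfRings.{u, v, w} X}

theorem exists_localSection (y : X) (a : 𝒪.stalk y) :
    ∃ (V : Set X) (s : ∀ z, 𝒪.stalk z), IsOpen V ∧ y ∈ V ∧
      ContinuousOn (fun z => (⟨z, s z⟩ : Σ x, 𝒪.stalk x)) V ∧ s y = a := by
  let e := 𝒪.isLocalHomeomorph_proj.localInverseAt ⟨y, a⟩
  have hex : ∀ z, ∃ b : 𝒪.stalk z, z ∈ e.source → (⟨z, b⟩ : Σ x, 𝒪.stalk x) = e z := by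
    intro z
    by_cases hz : z ∈ e.source
    · have hfst : (e z).1 = z := 𝒪.isLocalHomeomorph_proj.apply_localInverseAt_of_mem hz
      exact ⟨hfst ▸ (e z).2, fun _ => Sigma.ext hfst.symm (eqRec_heq _ _)⟩
    · exact ⟨0, fun h => absurd h hz⟩
  choose s hs using hex
  have hy : y ∈ e.source := 𝒪.isLocalHomeomorph_proj.apply_self_mem_localInverseAt_source
  have hey : e y = ⟨y, a⟩ :=
    𝒪.isLocalHomeomorph_proj.localInverseAt_apply_self (x := (⟨y, a⟩ : Σ x, 𝒪.stalk x))
  exact ⟨e.source, s, e.open_source, hy, e.continuousOn.congr hs,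
    eq_of_heq (Sigma.mk.inj ((hs y hy).trans hey)).2⟩

theorem eventually_eq_of_continuousAt {y : X} {s s' : ∀ z, 𝒪.stalk z}
    (hs : ContinuousAt (fun z => (⟨z, s z⟩ : Σ x, 𝒪.stalk x)) y)
    (hs' : ContinuousAt (fun z => (⟨z, s' z⟩ : Σ x, 𝒪.stalk x)) y) (h : s y = s' y) :
    ∀ᶠ z in nhds y, s z = s' z := by
  obtain ⟨N, hN, hyN, hinj⟩ := 𝒪.isLocalHomeomorph_proj.isLocallyInjective ⟨y, s y⟩
  filter_upwards [hs.eventually_mem (hN.mem_nhds hyN),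
    hs'.eventually_mem (hN.mem_nhds (h ▸ hyN))] with z hz hz'
  exact eq_of_heq (Sigma.mk.inj (hinj hz hz' rfl)).2

section ContinuousOn

variable {Z : Type t} [TopologicalSpace Z] {D : Set Z} {g : Z → X} {a b : ∀ z, 𝒪.stalk (g z)}

theorem continuousOn_stalk_add
    (ha : ContinuousOn (fun z => (⟨g z, a z⟩ : Σ x, 𝒪.stalk x)) D)
    (hb : ContinuousOn (fun z => (⟨g z, b z⟩ : Σ x, 𝒪.stalk x)) D) :
    ContinuousOn (fun z => (⟨g z, a z + b z⟩ : Σ x, 𝒪.stalk x)) D := by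
  have hpair : ContinuousOn (fun z => (⟨a z, b z⟩ : FibrePair 𝒪.stalk)) D :=
    (Topology.IsInducing.mk rfl).continuousOn_iff.mpr (ha.prodMk hb)
  exact 𝒪.continuous_add.comp_continuousOn hpair

theorem continuousOn_stalk_mul
    (ha : ContinuousOn (fun z => (⟨g z, a z⟩ : Σ x, 𝒪.stalk x)) D)
    (hb : ContinuousOn (fun z => (⟨g z, b z⟩ : Σ x, 𝒪.stalk x)) D) :
    ContinuousOn (fun z => (⟨g z, a z * b z⟩ : Σ x, 𝒪.stalk x)) D := by
  have hpair : ContinuousOn (fun z => (⟨a z, b z⟩ : FibrePair 𝒪.stalk)) D :=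
    (Topology.IsInducing.mk rfl).continuousOn_iff.mpr (ha.prodMk hb)
  exact 𝒪.continuous_mul.comp_continuousOn hpair

theorem continuous_stalk_zero : Continuous (fun z : X => (⟨z, 0⟩ : Σ x, 𝒪.stalk x)) := by
  refine continuous_iff_continuousAt.mpr fun y => ?_
  obtain ⟨V, s, hV, hy, hs, hsy⟩ := exists_localSection (𝒪 := 𝒪) y 0
  have hcont := hs.continuousAt (hV.mem_nhds hy)
  have hcont_add := (continuousOn_stalk_add hs hs).continuousAt (hV.mem_nhds hy)
  refine hcont.congr ?_
  filter_upwards [eventually_eq_of_continuousAt hcont_add hcont (by simp [hsy])] with z hz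
  rw [add_eq_left.mp hz]

theorem continuous_stalk_neg_one : Continuous (fun z : X => (⟨z, -1⟩ : Σ x, 𝒪.stalk x)) := by
  refine continuous_iff_continuousAt.mpr fun y => ?_
  obtain ⟨V, s, hV, hy, hs, hsy⟩ := exists_localSection (𝒪 := 𝒪) y (-1)
  have hcont_add := (continuousOn_stalk_add hs 𝒪.continuous_one.continuousOn).continuousAt
    (hV.mem_nhds hy)
  refine (hs.continuousAt (hV.mem_nhds hy)).congr ?_
  filter_upwards [eventually_eq_of_continuousAt hcont_add continuous_stalk_zero.continuousAt
    (by simp [hsy])] with z hz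
  rw [eq_neg_of_add_eq_zero_left hz]

theorem continuousOn_stalk_neg
    (ha : ContinuousOn (fun z => (⟨g z, a z⟩ : Σ x, 𝒪.stalk x)) D) :
    ContinuousOn (fun z => (⟨g z, -a z⟩ : Σ x, 𝒪.stalk x)) D := by
  have hg : ContinuousOn g D := 𝒪.isLocalHomeomorph_proj.continuous.comp_continuousOn ha
  have hneg_one : ContinuousOn (fun z => (⟨g z, -1⟩ : Σ x, 𝒪.stalk x)) D :=
    continuous_stalk_neg_one.comp_continuousOn hg
  simpa only [neg_one_mul] using continuousOn_stalk_mul hneg_one ha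

theorem continuousOn_stalk_sub
    (ha : ContinuousOn (fun z => (⟨g z, a z⟩ : Σ x, 𝒪.stalk x)) D)
    (hb : ContinuousOn (fun z => (⟨g z, b z⟩ : Σ x, 𝒪.stalk x)) D) :
    ContinuousOn (fun z => (⟨g z, a z - b z⟩ : Σ x, 𝒪.stalk x)) D := by
  simpa only [sub_eq_add_neg] using continuousOn_stalk_add ha (continuousOn_stalk_neg hb)

end ContinuousOn

theorem continuousOn_stalk_act {D : Set (Arr X)} {a : ∀ γ : Arr X, 𝒪.stalk γ.left}
    (ha : ContinuousOn (fun γ : Arr X => (⟨γ.left, a γ⟩ : Σ x, 𝒪.stalk x)) D) :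
    ContinuousOn (fun γ : Arr X => (⟨γ.right, 𝒪.act γ.hom (a γ)⟩ : Σ x, 𝒪.stalk x)) D := by
  have hpair : ContinuousOn (fun γ : Arr X => (⟨γ.hom, a γ⟩ : ActPair 𝒪.stalk)) D :=
    (Topology.IsInducing.mk rfl).continuousOn_iff.mpr (continuousOn_id.prodMk ha)
  exact 𝒪.continuous_act.comp_continuousOn hpair

end Stalkwise

section Bisections

variable {X : Type u} [Groupoid.{v} X] [TopologicalSpace X] [TopologicalSpace (Arr X)]
  [IsAmpleGroupoid X]

/-- Inversion of arrows, as a homeomorphism of the arrow space. -/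
def invHomeomorph : Arr X ≃ₜ Arr X where
  toFun γ := ⟨γ.right, γ.left, Groupoid.inv γ.hom⟩
  invFun γ := ⟨γ.right, γ.left, Groupoid.inv γ.hom⟩
  left_inv γ := by simp
  right_inv γ := by simp
  continuous_toFun := IsAmpleGroupoid.continuous_inv
  continuous_invFun := IsAmpleGroupoid.continuous_inv

theorem continuous_range : Continuous (fun γ : Arr X => γ.right) :=
  (IsAmpleGroupoid.isLocalHomeomorph_range (X := X)).continuous

theorem isLocalHomeomorph_dom : IsLocalHomeomorph (fun γ : Arr X => γ.left) :=
  (IsAmpleGroupoid.isLocalHomeomorph_range (X := X)).comp invHomeomorph.isLocalHomeomorph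

theorem isOpen_unitArrows : IsOpen (unitArrows X) := by
  have hr := IsAmpleGroupoid.isLocalHomeomorph_range (X := X)
  have hid : IsLocalHomeomorph (id : X → X) := (Homeomorph.refl X).isLocalHomeomorph
  have hunit : IsLocalHomeomorph (fun x : X => (⟨x, x, 𝟙 x⟩ : Arr X)) :=
    .of_comp (g := fun γ : Arr X => γ.right) hid hr IsAmpleGroupoid.continuous_unit
  exact hunit.isOpenMap.isOpen_range

theorem exists_isCompactOpenBisection {γ : Arr X} {N : Set (Arr X)} (hN : IsOpen N)
    (hγ : γ ∈ N) : ∃ U, IsCompactOpenBisection U ∧ γ ∈ U ∧ U ⊆ N := by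
  have hr := IsAmpleGroupoid.isLocalHomeomorph_range (X := X)
  let e := hr.localInverseAt γ
  have heγ : e γ.right = γ := hr.localInverseAt_apply_self
  obtain ⟨D, hD, hγD, hinj⟩ := isLocalHomeomorph_dom.isLocallyInjective γ
  have hnhds : IsOpen (e.source ∩ e ⁻¹' (N ∩ D)) := e.isOpen_inter_preimage (hN.inter hD)
  have hmem : γ.right ∈ e.source ∩ e ⁻¹' (N ∩ D) :=
    ⟨hr.apply_self_mem_localInverseAt_source, by
      simpa only [Set.mem_preimage, heγ] using ⟨hγ, hγD⟩⟩
  obtain ⟨K, ⟨hKo, hKc⟩, hγK, hK⟩ :=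
    IsAmpleGroupoid.isTopologicalBasis_compactOpen.exists_subset_of_mem_open hmem hnhds
  have hsub : e '' K ⊆ N ∩ D := Set.image_subset_iff.mpr fun z hz => (hK hz).2
  have htarget : e '' K ⊆ e.target := Set.image_subset_iff.mpr fun z hz => e.map_source (hK hz).1
  exact ⟨e '' K,
    { isOpen := e.isOpen_image_of_subset_source hKo fun z hz => (hK hz).1
      isCompact := hKc.image_of_continuousOn (e.continuousOn.mono fun z hz => (hK hz).1)
      injOn_dom := hinj.mono fun β hβ => (hsub hβ).2
      injOn_range := hr.injOn_localInverseAt_target.mono htarget },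
    ⟨γ.right, hγK, heγ⟩, fun β hβ => (hsub hβ).1⟩

theorem exists_supportedOn {𝒪 : GSheafOfRings.{u, v, w} X} {γ : Arr X} {N : Set (Arr X)}
    (hN : IsOpen N) (hγ : γ ∈ N) (a : 𝒪.stalk γ.right) :
    ∃ (U : Set (Arr X)) (f : Sections 𝒪),
      IsCompactOpenBisection U ∧ γ ∈ U ∧ U ⊆ N ∧ SupportedOn f U ∧ f γ = a := by
  classical
  obtain ⟨V, s, hV, hy, hs, rfl⟩ := exists_localSection γ.right a
  obtain ⟨U, hU, hγU, hUN⟩ := exists_isCompactOpenBisection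
    (hN.inter (hV.preimage continuous_range)) (γ := γ) ⟨hγ, hy⟩
  refine ⟨U, fun β => if β ∈ U then s β.right else 0, hU, hγU,
    hUN.trans Set.inter_subset_left, ⟨?_, fun β hβ => if_neg hβ⟩, if_pos hγU⟩
  refine (hs.comp continuous_range.continuousOn fun β hβ => (hUN hβ).2).congr fun β hβ => ?_
  simp only [toSpace, hβ, if_true, Function.comp_apply]

end Bisections

section EllSingle

variable {X : Type u} [Groupoid.{v} X] [TopologicalSpace X] [TopologicalSpace (Arr X)]
  {𝒪 : GSheafOfRings.{u, v, w} X} {x y z : X}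

open Classical in
/-- The element `a 1_γ` of `𝓛_x`, for an arrow `γ : x ⟶ y` and `a ∈ 𝒪_y`. -/
noncomputable def ellSingle (γ : x ⟶ y) : 𝒪.stalk y →+ Ell 𝒪 x :=
  DirectSum.of (fun γ : Out x => 𝒪.stalk γ.1) ⟨y, γ⟩

theorem ellSingle_apply_self (γ : x ⟶ y) (a : 𝒪.stalk y) : ellSingle γ a ⟨y, γ⟩ = a := by
  classical exact DirectSum.of_eq_same _ _

theorem ellSingle_apply_of_ne (γ : x ⟶ y) (a : 𝒪.stalk y) {σ : Out x} (hσ : σ ≠ ⟨y, γ⟩) :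
    ellSingle γ a σ = 0 := by
  classical exact DirectSum.of_eq_of_ne _ _ _ hσ

theorem Ell.induction {p : Ell 𝒪 x → Prop} (ξ : Ell 𝒪 x)
    (single : ∀ {y : X} (γ : x ⟶ y) (a : 𝒪.stalk y), p (ellSingle γ a))
    (add : ∀ ξ η, p ξ → p η → p (ξ + η)) : p ξ := by
  classical
  induction ξ using DirectSum.induction_on with
  | zero => simpa only [map_zero] using single (𝟙 x) 0
  | of γ a => exact single γ.2 a
  | add ξ η hξ hη => exact add ξ η hξ hη

theorem shift_ellSingle (γ : x ⟶ y) (β : y ⟶ z) (b : 𝒪.stalk z) (a : 𝒪.stalk y) :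
    shift γ (ellSingle β b) a = ellSingle (γ ≫ β) (b * 𝒪.act β a) := by
  classical exact shift_of γ ⟨z, β⟩ b a

theorem leftAct_ellSingle (f : Gamma 𝒪) (γ : x ⟶ y) (a : 𝒪.stalk y) :
    leftAct x f (ellSingle γ a) = shift γ (res y f) a := by
  classical exact leftAct_of f ⟨y, γ⟩ a

theorem rightAct_single_ellSingle (δ : End x) (b : 𝒪.stalk x) (γ : x ⟶ y) (a : 𝒪.stalk y) :
    rightAct x (SkewMonoidAlgebra.single δ b) (ellSingle γ a) =
      ellSingle ((δ : x ⟶ x) ≫ γ) (a * 𝒪.act γ b) := by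
  classical
  rw [rightAct_single]
  exact rightActSingle_of x δ b ⟨y, γ⟩ a

theorem res_eq_ellSingle {f : Gamma 𝒪} (γ : x ⟶ y)
    (hf : ∀ σ : Out x, σ ≠ ⟨y, γ⟩ → f.1 σ.arr = 0) :
    res x f = ellSingle γ (f.1 ⟨x, y, γ⟩) := by
  ext σ
  rw [res_apply]
  by_cases hσ : σ = ⟨y, γ⟩
  · rw [hσ, ellSingle_apply_self]
  · rw [ellSingle_apply_of_ne γ _ hσ, hf σ hσ]

end EllSingle

section Diagonal

variable {X : Type u} [Groupoid.{v} X] [TopologicalSpace X] [TopologicalSpace (Arr X)]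
  {𝒪 : GSheafOfRings.{u, v, w} X}

/-- The value of a section at the unit arrow of `x`. Stating it for `x`, and not for the unit arrow,
makes it an element of `𝒪_x` on the nose. -/
def unitValue (f : Sections 𝒪) (x : X) : 𝒪.stalk x := f ⟨x, x, 𝟙 x⟩

theorem apply_eq_zero_of_mem_gammaUnitSubgroup {a : Sections 𝒪} (ha : a ∈ gammaUnitSubgroup 𝒪)
    {γ : Arr X} (hγ : γ ∉ unitArrows X) : a γ = 0 := by
  induction ha using AddSubgroup.closure_induction with
  | mem a ha =>
    obtain ⟨U, hU, -, hsupp⟩ := ha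
    exact hsupp.2 γ fun h => hγ (hU h)
  | zero => rfl
  | add a b _ _ ha hb => rw [Pi.add_apply, ha, hb, add_zero]
  | neg a _ ha => rw [Pi.neg_apply, ha, neg_zero]

theorem eq_id_of_mem_unitArrows {x y : X} {γ : x ⟶ y} (hγ : (⟨x, y, γ⟩ : Arr X) ∈ unitArrows X) :
    (⟨y, γ⟩ : Out x) = ⟨x, 𝟙 x⟩ := by
  obtain ⟨z, hz⟩ := hγ
  obtain rfl : z = x := congrArg Quiver.Total.left hz
  exact Out.arr_injective hz.symm

theorem res_of_mem_gammaUnitSubgroup {a : Gamma 𝒪} (ha : a.1 ∈ gammaUnitSubgroup 𝒪) (x : X) :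
    res x a = ellSingle (𝟙 x) (unitValue a.1 x) :=
  res_eq_ellSingle (𝟙 x) fun _ hσ =>
    apply_eq_zero_of_mem_gammaUnitSubgroup ha fun h => hσ (eq_id_of_mem_unitArrows h)

theorem leftAct_ellSingle_of_mem_gammaUnitSubgroup {a : Gamma 𝒪}
    (ha : a.1 ∈ gammaUnitSubgroup 𝒪) {x y : X} (γ : x ⟶ y) (b : 𝒪.stalk y) :
    leftAct x a (ellSingle γ b) = ellSingle γ (unitValue a.1 y * b) := by
  rw [leftAct_ellSingle, res_of_mem_gammaUnitSubgroup ha, shift_ellSingle, 𝒪.act_id,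
    Category.comp_id]

theorem leftAct_apply_of_mem_gammaUnitSubgroup {a : Gamma 𝒪} (ha : a.1 ∈ gammaUnitSubgroup 𝒪)
    {x : X} (ξ : Ell 𝒪 x) (σ : Out x) : leftAct x a ξ σ = unitValue a.1 σ.1 * ξ σ := by
  induction ξ using Ell.induction with
  | @single y γ b =>
    rw [leftAct_ellSingle_of_mem_gammaUnitSubgroup ha]
    by_cases hσ : σ = ⟨y, γ⟩
    · rw [hσ, ellSingle_apply_self, ellSingle_apply_self]
    · rw [ellSingle_apply_of_ne γ _ hσ, ellSingle_apply_of_ne γ _ hσ, mul_zero]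
  | add ξ η hξ hη => rw [map_add, DirectSum.add_apply, hξ, hη, DirectSum.add_apply, mul_add]

variable [IsAmpleGroupoid X]

theorem SupportedOn.continuous_unitValue {a : Sections 𝒪} {W : Set (Arr X)}
    (hW : IsCompactOpenBisection W) (hWu : W ⊆ unitArrows X) (ha : SupportedOn a W) :
    Continuous (fun x : X => (⟨x, unitValue a x⟩ : Σ x, 𝒪.stalk x)) := by
  have : T2Space X := IsAmpleGroupoid.t2
  let unit : X → Arr X := fun x => ⟨x, x, 𝟙 x⟩
  have hpre : unit ⁻¹' W = (fun γ : Arr X => γ.right) '' W := by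
    refine Set.Subset.antisymm (fun x hx => ⟨unit x, hx, rfl⟩) ?_
    rintro _ ⟨γ, hγ, rfl⟩
    obtain ⟨y, rfl⟩ := hWu hγ
    exact hγ
  have hclosed : IsClosed (unit ⁻¹' W) := hpre ▸ (hW.isCompact.image continuous_range).isClosed
  refine continuous_iff_continuousAt.mpr fun x => ?_
  by_cases hx : unit x ∈ W
  · exact (ha.1.continuousAt (hW.isOpen.mem_nhds hx)).comp (f := unit)
      IsAmpleGroupoid.continuous_unit.continuousAt
  · refine continuous_stalk_zero.continuousAt.congr ?_
    filter_upwards [hclosed.isOpen_compl.mem_nhds hx] with z hz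
    rw [unitValue, ha.2 _ hz]

theorem continuous_unitValue {a : Sections 𝒪} (ha : a ∈ gammaUnitSubgroup 𝒪) :
    Continuous (fun x : X => (⟨x, unitValue a x⟩ : Σ x, 𝒪.stalk x)) := by
  induction ha using AddSubgroup.closure_induction with
  | mem a ha =>
    obtain ⟨W, hWu, hW, hsupp⟩ := ha
    exact hsupp.continuous_unitValue hW hWu
  | zero => exact continuous_stalk_zero
  | add a b _ _ ha hb =>
    exact continuousOn_univ.mp (continuousOn_stalk_add ha.continuousOn hb.continuousOn)
  | neg a _ ha => exact continuousOn_univ.mp (continuousOn_stalk_neg ha.continuousOn)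

theorem mul_apply_of_left_mem_gammaUnit {a : Gamma 𝒪} (ha : a ∈ gammaUnit 𝒪) (f : Gamma 𝒪)
    (γ : Arr X) : (a * f).1 γ = unitValue a.1 γ.right * f.1 γ := by
  have h := leftAct_apply_of_mem_gammaUnitSubgroup ha (res γ.left f) ⟨γ.right, γ.hom⟩
  rwa [← res_mul, res_apply, res_apply] at h

theorem mul_apply_of_right_mem_gammaUnit {a : Gamma 𝒪} (ha : a ∈ gammaUnit 𝒪) (f : Gamma 𝒪)
    (γ : Arr X) : (f * a).1 γ = f.1 γ * 𝒪.act γ.hom (unitValue a.1 γ.left) := by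
  have h : res γ.left (f * a) ⟨γ.right, γ.hom⟩ =
      shift (𝟙 γ.left) (res γ.left f) (unitValue a.1 γ.left) ⟨γ.right, γ.hom⟩ := by
    rw [res_mul, res_of_mem_gammaUnitSubgroup ha, leftAct_ellSingle]
  rw [shift_apply, Groupoid.inv_eq_inv, IsIso.inv_id, Category.id_comp, res_apply, res_apply] at h
  exact h

theorem unitValue_mul_of_right_mem_gammaUnit {a : Gamma 𝒪} (ha : a ∈ gammaUnit 𝒪) (f : Gamma 𝒪)
    (x : X) : unitValue (f * a).1 x = unitValue f.1 x * unitValue a.1 x := by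
  rw [unitValue, mul_apply_of_right_mem_gammaUnit ha]
  exact congrArg (unitValue f.1 x * ·) (𝒪.act_id x _)

theorem eq_zero_of_unitValue_eq_zero {a : Gamma 𝒪} (ha : a ∈ gammaUnit 𝒪)
    (h : ∀ x, unitValue a.1 x = 0) : a = 0 :=
  Gamma.ext_res fun x => by
    rw [res_of_mem_gammaUnitSubgroup ha, h, map_zero, map_zero]

end Diagonal

section Bisectional

variable {X : Type u} [Groupoid.{v} X] [TopologicalSpace X] [TopologicalSpace (Arr X)]
  {𝒪 : GSheafOfRings.{u, v, w} X}

/-- The generators of `Γ_c(𝒢, 𝒪)`: sections supported on a single compact open bisection. -/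
def IsBisectional (f : Gamma 𝒪) : Prop :=
  ∃ U : Set (Arr X), IsCompactOpenBisection U ∧ SupportedOn f.1 U

theorem SupportedOn.neg {f : Sections 𝒪} {U : Set (Arr X)} (hf : SupportedOn f U) :
    SupportedOn (-f) U :=
  ⟨continuousOn_stalk_neg hf.1, fun γ hγ => by rw [Pi.neg_apply, hf.2 γ hγ, neg_zero]⟩

theorem SupportedOn.sub {f g : Sections 𝒪} {U : Set (Arr X)} (hf : SupportedOn f U)
    (hg : SupportedOn g U) : SupportedOn (f - g) U :=
  ⟨continuousOn_stalk_sub hf.1 hg.1, fun γ hγ => by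
    rw [Pi.sub_apply, hf.2 γ hγ, hg.2 γ hγ, sub_zero]⟩

theorem IsBisectional.neg {f : Gamma 𝒪} (hf : IsBisectional f) : IsBisectional (-f) :=
  let ⟨U, hU, hsupp⟩ := hf
  ⟨U, hU, hsupp.neg⟩

theorem exists_multiset_isBisectional_sum_eq (f : Gamma 𝒪) :
    ∃ l : Multiset (Gamma 𝒪), (∀ g ∈ l, IsBisectional g) ∧ l.sum = f := by
  obtain ⟨f, hf⟩ := f
  induction hf using AddSubgroup.closure_induction with
  | mem f hf =>
    have hbis : IsBisectional ⟨f, AddSubgroup.subset_closure hf⟩ := hf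
    exact ⟨{_}, fun g hg => Multiset.mem_singleton.mp hg ▸ hbis, Multiset.sum_singleton _⟩
  | zero => exact ⟨0, fun g hg => absurd hg (Multiset.notMem_zero g), Multiset.sum_zero⟩
  | add f g _ _ hf hg =>
    obtain ⟨l, hl, hsum⟩ := hf
    obtain ⟨l', hl', hsum'⟩ := hg
    refine ⟨l + l', fun g hg => (Multiset.mem_add.mp hg).elim (hl g) (hl' g), ?_⟩
    rw [Multiset.sum_add, hsum, hsum']
    rfl
  | neg f _ hf =>
    obtain ⟨l, hl, hsum⟩ := hf
    refine ⟨l.map Neg.neg, ?_, ?_⟩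
    · simp only [Multiset.mem_map]
      rintro _ ⟨g, hg, rfl⟩
      exact (hl g hg).neg
    · rw [Multiset.sum_map_neg', hsum]
      rfl

variable [IsAmpleGroupoid X]

theorem SupportedOn.mul_left_mem_gammaUnit {a f : Gamma 𝒪} {U : Set (Arr X)}
    (ha : a ∈ gammaUnit 𝒪) (hf : SupportedOn f.1 U) : SupportedOn (a * f).1 U := by
  have hcont : ContinuousOn (fun γ : Arr X =>
      (⟨γ.right, unitValue a.1 γ.right⟩ : Σ x, 𝒪.stalk x)) U :=
    ((SheafAlgebra.continuous_unitValue ha).comp continuous_range).continuousOn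
  refine ⟨(continuousOn_stalk_mul hcont hf.1).congr fun γ _ => ?_, fun γ hγ => ?_⟩
  · rw [toSpace, mul_apply_of_left_mem_gammaUnit ha]
  · rw [mul_apply_of_left_mem_gammaUnit ha, hf.2 γ hγ, mul_zero]

theorem SupportedOn.mul_right_mem_gammaUnit {a f : Gamma 𝒪} {U : Set (Arr X)}
    (ha : a ∈ gammaUnit 𝒪) (hf : SupportedOn f.1 U) : SupportedOn (f * a).1 U := by
  have hcont : ContinuousOn (fun γ : Arr X =>
      (⟨γ.left, unitValue a.1 γ.left⟩ : Σ x, 𝒪.stalk x)) U :=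
    ((SheafAlgebra.continuous_unitValue ha).comp IsAmpleGroupoid.continuous_dom).continuousOn
  refine ⟨(continuousOn_stalk_mul hf.1 (continuousOn_stalk_act hcont)).congr fun γ _ => ?_,
    fun γ hγ => ?_⟩
  · rw [toSpace, mul_apply_of_right_mem_gammaUnit ha]
  · rw [mul_apply_of_right_mem_gammaUnit ha, hf.2 γ hγ, zero_mul]

theorem IsBisectional.mul {f g : Gamma 𝒪} (hf : IsBisectional f) (hg : IsBisectional g) :
    IsBisectional (f * g) :=
  let ⟨_, hU, hfU⟩ := hf
  let ⟨_, hV, hgV⟩ := hg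
  ⟨_, isCompactOpenBisection_setMul hU hV, supportedOn_conv hV hfU hgV⟩

theorem IsBisectional.mul_sub_mul_of_mem_gammaUnit {a f : Gamma 𝒪} (ha : a ∈ gammaUnit 𝒪)
    (hf : IsBisectional f) : IsBisectional (a * f - f * a) :=
  let ⟨U, hU, hsupp⟩ := hf
  ⟨U, hU, (hsupp.mul_left_mem_gammaUnit ha).sub (hsupp.mul_right_mem_gammaUnit ha)⟩

theorem exists_isBisectional_res_eq {x y : X} (γ : x ⟶ y) (a : 𝒪.stalk y) :
    ∃ g : Gamma 𝒪, IsBisectional g ∧ res x g = ellSingle γ a := by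
  obtain ⟨U, f, hU, hγU, -, hf, hfa⟩ :=
    exists_supportedOn isOpen_univ (Set.mem_univ (⟨x, y, γ⟩ : Arr X)) a
  refine ⟨⟨f, AddSubgroup.subset_closure ⟨U, hU, hf⟩⟩, ⟨U, hU, hf⟩, ?_⟩
  rw [← hfa]
  exact res_eq_ellSingle γ fun σ hσ =>
    hf.2 _ fun hσU => hσ (Out.arr_injective (hU.injOn_dom hσU hγU rfl))

theorem exists_isBisectional_unitValue_mul_eq (γ : Arr X) :
    ∃ g : Gamma 𝒪, IsBisectional g ∧ ∀ f : Gamma 𝒪, unitValue (f * g).1 γ.right = f.1 γ := by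
  obtain ⟨g, hg, hres⟩ := exists_isBisectional_res_eq (Groupoid.inv γ.hom) (1 : 𝒪.stalk γ.left)
  refine ⟨g, hg, fun f => ?_⟩
  have hinv : Groupoid.inv (Groupoid.inv γ.hom) ≫ 𝟙 γ.right = γ.hom := by
    rw [Category.comp_id, Groupoid.inv_eq_inv, Groupoid.inv_eq_inv, IsIso.inv_inv]
  calc unitValue (f * g).1 γ.right = res γ.right (f * g) ⟨γ.right, 𝟙 γ.right⟩ := by
        rw [res_apply, unitValue]
    _ = res γ.left f ⟨γ.right, γ.hom⟩ := by
        rw [res_mul, hres, leftAct_ellSingle, shift_apply, map_one, mul_one, hinv]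
    _ = f.1 γ := res_apply _ _ _

theorem exists_mem_gammaUnit_unitValue_eq {y : X} {N : Set (Arr X)} (hN : IsOpen N)
    (hy : (⟨y, y, 𝟙 y⟩ : Arr X) ∈ N) (a : 𝒪.stalk y) :
    ∃ (W : Set (Arr X)) (e : Gamma 𝒪), e ∈ gammaUnit 𝒪 ∧ IsCompactOpenBisection W ∧
      W ⊆ N ∩ unitArrows X ∧ SupportedOn e.1 W ∧ unitValue e.1 y = a := by
  obtain ⟨W, e, hW, -, hWN, he, hea⟩ :=
    exists_supportedOn (hN.inter isOpen_unitArrows) ⟨hy, y, rfl⟩ a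
  have hmem : e ∈ gammaUnitSubgroup 𝒪 :=
    AddSubgroup.subset_closure ⟨W, hWN.trans Set.inter_subset_right, hW, he⟩
  exact ⟨W, ⟨e, gammaUnitSubgroup_le 𝒪 hmem⟩, hmem, hW, hWN, he, hea⟩

theorem IsBisectional.exists_mul_mem_gammaUnit {k : Gamma 𝒪} (hk : IsBisectional k) {y : X}
    (hy : unitValue k.1 y ≠ 0) :
    ∃ e ∈ gammaUnit 𝒪, IsBisectional e ∧ unitValue e.1 y = 1 ∧ k * e ∈ gammaUnit 𝒪 := by
  obtain ⟨V, hV, hkV⟩ := hk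
  have hyV : (⟨y, y, 𝟙 y⟩ : Arr X) ∈ V := by_contra fun h => hy (hkV.2 _ h)
  obtain ⟨W, e, he, hW, hWV, hsupp, he1⟩ := exists_mem_gammaUnit_unitValue_eq hV.isOpen hyV
    (1 : 𝒪.stalk y)
  refine ⟨e, he, ⟨W, hW, hsupp⟩, he1, AddSubgroup.subset_closure
    ⟨W, hWV.trans Set.inter_subset_right, hW,
      (hkV.mul_right_mem_gammaUnit he).1.mono (hWV.trans Set.inter_subset_left),
      fun γ hγ => ?_⟩⟩
  rw [mul_apply_of_right_mem_gammaUnit he]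
  -- An arrow of `V` over a unit of `W ⊆ V` is that unit, because `V` is a bisection.
  by_cases hγV : γ ∈ V
  · have hunit : (⟨γ.left, γ.left, 𝟙 γ.left⟩ : Arr X) ∉ W := fun h =>
      hγ (hV.injOn_dom hγV (hWV h).1 rfl ▸ h)
    rw [unitValue, hsupp.2 _ hunit, map_zero, mul_zero]
  · rw [hkV.2 γ hγV, zero_mul]

theorem exists_mul_mem_gammaUnit_of_sum_ne_zero {l : Multiset (Gamma 𝒪)}
    (hl : ∀ f ∈ l, IsBisectional f) (hsum : l.sum ≠ 0) :
    ∃ c : Gamma 𝒪, IsBisectional c ∧ l.sum * c ≠ 0 ∧ ∃ f ∈ l, f * c ∈ gammaUnit 𝒪 := by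
  obtain ⟨γ, hγ⟩ : ∃ γ, l.sum.1 γ ≠ 0 := by
    by_contra! h
    exact hsum (Subtype.ext (funext h))
  obtain ⟨g, hg, hgγ⟩ := exists_isBisectional_unitValue_mul_eq (𝒪 := 𝒪) γ
  obtain ⟨f, hfl, hfγ⟩ : ∃ f ∈ l, f.1 γ ≠ 0 := by
    by_contra! h
    let ev : Gamma 𝒪 →+ 𝒪.stalk γ.right :=
      (Pi.evalAddMonoidHom _ γ).comp (gammaSubgroup 𝒪).subtype
    exact hγ ((map_multiset_sum ev l).trans (Multiset.sum_eq_zero fun b hb => by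
      obtain ⟨f, hf, rfl⟩ := Multiset.mem_map.mp hb
      exact h f hf))
  obtain ⟨e, he, hbis, he1, hmem⟩ :=
    ((hl f hfl).mul hg).exists_mul_mem_gammaUnit (y := γ.right) (by rwa [hgγ])
  refine ⟨g * e, hg.mul hbis, fun h => hγ ?_, f, hfl, by rwa [← mul_assoc]⟩
  calc l.sum.1 γ = unitValue (l.sum * g * e).1 γ.right := by
        rw [unitValue_mul_of_right_mem_gammaUnit he, hgγ, he1, mul_one]
    _ = 0 := by
        rw [mul_assoc, h]
        rfl

end Bisectional

section MaximalCommutative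

theorem IsMaximalCommutative.mem_of_forall_commute {R : Type u} [NonUnitalRing R]
    {S : NonUnitalSubring R} (hS : IsMaximalCommutative S) {p : R}
    (hp : ∀ a ∈ S, a * p = p * a) : p ∈ S := by
  have hcomm : ∀ a ∈ insert p (S : Set R), ∀ b ∈ insert p (S : Set R), a * b = b * a := by
    rintro a (rfl | ha) b (rfl | hb)
    · rfl
    · exact (hp b hb).symm
    · exact hp a ha
    · exact hS.1 a ha b hb
  have := NonUnitalSubring.isMulCommutative_closure hcomm
  have hle : NonUnitalSubring.closure (insert p (S : Set R)) ≤ S :=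
    hS.2 (fun a ha b hb => setLike_mul_comm ha hb)
      (Set.Subset.trans (Set.subset_insert p _) NonUnitalSubring.subset_closure)
  exact hle (NonUnitalSubring.subset_closure (Set.mem_insert p _))

variable {X : Type u} [Groupoid.{v} X] [TopologicalSpace X] [TopologicalSpace (Arr X)]
  [IsAmpleGroupoid X] {𝒪 : GSheafOfRings.{u, v, w} X}

theorem sum_eq_zero_of_sum_mem (hmax : IsMaximalCommutative (gammaUnit 𝒪))
    {I : TwoSidedIdeal (Gamma 𝒪)} (hI : ∀ f ∈ I, f ∈ gammaUnit 𝒪 → f = 0) (n : ℕ) :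
    ∀ l : Multiset (Gamma 𝒪), l.card = n → (∀ f ∈ l, IsBisectional f) → l.sum ∈ I →
      l.sum = 0 := by
  induction n with
  | zero => exact fun l hl _ _ => by rw [Multiset.card_eq_zero.mp hl, Multiset.sum_zero]
  | succ n ih =>
    intro l hcard hl hlI
    by_contra hne
    obtain ⟨c, hc, hsum, f, hfl, hfc⟩ := exists_mul_mem_gammaUnit_of_sum_ne_zero hl hne
    obtain ⟨l, rfl⟩ := Multiset.exists_cons_of_mem hfl
    have hmem : (f ::ₘ l).sum * c ∈ I := I.mul_mem_right _ _ hlI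
    refine hsum (hI _ hmem (hmax.mem_of_forall_commute fun a ha => sub_eq_zero.mp ?_))
    -- The summand `f * c` is diagonal, so it drops out of the commutator with `a`.
    have hcomm : (l.map fun g => a * (g * c) - g * c * a).sum =
        a * ((f ::ₘ l).sum * c) - (f ::ₘ l).sum * c * a := by
      rw [Multiset.sum_map_sub, Multiset.sum_map_mul_left, Multiset.sum_map_mul_right,
        Multiset.sum_map_mul_right, Multiset.map_id', Multiset.sum_cons, add_mul, mul_add, add_mul,
        hmax.1 a ha _ hfc, add_sub_add_left_eq_sub, Multiset.sum_map_mul_right, Multiset.map_id']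
    rw [← hcomm]
    refine ih _ ?_ ?_ ?_
    · rw [Multiset.card_map]
      exact Nat.succ_injective ((Multiset.card_cons f l).symm.trans hcard)
    · intro h hh
      obtain ⟨g, hg, rfl⟩ := Multiset.mem_map.mp hh
      exact ((hl g (Multiset.mem_cons_of_mem hg)).mul hc).mul_sub_mul_of_mem_gammaUnit ha
    · rw [hcomm]
      exact I.sub_mem (I.mul_mem_left _ _ hmem) (I.mul_mem_right _ _ hmem)

theorem eq_bot_of_forall_mem_gammaUnit_eq_zero (hmax : IsMaximalCommutative (gammaUnit 𝒪))
    {I : TwoSidedIdeal (Gamma 𝒪)} (hI : ∀ f ∈ I, f ∈ gammaUnit 𝒪 → f = 0) : I = ⊥ := by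
  refine eq_bot_iff.mpr fun f hf => (TwoSidedIdeal.mem_bot _).mpr ?_
  obtain ⟨l, hl, rfl⟩ := exists_multiset_isBisectional_sum_eq f
  exact sum_eq_zero_of_sum_mem hmax hI l.card l rfl hl hf

end MaximalCommutative

section NonUnitalModules

variable {R : Type u} [NonUnitalRing R]

theorem IsSimple.isSimpleSubmodule_range {M : Type v} {N : Type t} [AddCommGroup M]
    [AddCommGroup N] {ρ : R →ₙ+* AddMonoid.End M} {σ : R →ₙ+* AddMonoid.End N} (h : IsSimple ρ)
    (φ : M →+ N) (hφ : Function.Injective φ) (hφρ : ∀ r m, σ r (φ m) = φ (ρ r m)) :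
    IsSimpleSubmodule σ φ.range := by
  obtain ⟨-, ⟨r, m, -, hrm⟩, hsub⟩ := h
  refine ⟨?_, ⟨r, φ m, ⟨m, rfl⟩, ?_⟩, fun K hK hle => ?_⟩
  · rintro s _ ⟨n, rfl⟩
    exact ⟨ρ s n, (hφρ s n).symm⟩
  · rw [hφρ]
    exact (map_ne_zero_iff φ hφ).mpr hrm
  · have hK' : K = (K.comap φ).map φ := by rw [AddSubgroup.map_comap_eq, inf_eq_right.mpr hle]
    have hcomap : IsSubmodule ρ (K.comap φ) := fun s n hn => by
      rw [AddSubgroup.mem_comap, ← hφρ]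
      exact hK s _ hn
    refine (hsub _ hcomap le_top).imp (fun h => ?_) fun h => ?_
    · rw [hK', h, AddSubgroup.map_bot]
    · rw [hK', h, AddMonoidHom.range_eq_map]

theorem isSemiprimitive_of_forall_isSimple {ι : Type v} {M : ι → Type u}
    [∀ i, AddCommGroup (M i)] {ρ : ∀ i, R →ₙ+* AddMonoid.End (M i)} (hρ : ∀ i, IsSimple (ρ i))
    (h : ∀ r, (∀ i m, ρ i r m = 0) → r = 0) : IsSemiprimitive R := by
  refine Set.Subset.antisymm (fun r hr => h r fun i => hr (M i) (ρ i) (hρ i)) ?_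
  rintro _ rfl N _ σ - n
  rw [map_zero]
  rfl

variable {ι : Type v} {M : ι → Type t} [∀ i, AddCommGroup (M i)]
  {ρ : ∀ i, R →ₙ+* AddMonoid.End (M i)}

open Classical in
theorem directSumModule_of (r : R) (i : ι) (m : M i) :
    directSumModule ρ r (DirectSum.of M i m) = DirectSum.of M i (ρ i r m) :=
  DirectSum.map_of _ _ _

theorem isSemisimple_directSumModule (hρ : ∀ i, IsSimple (ρ i)) :
    IsSemisimple (directSumModule ρ) := by
  classical
  refine (AddSubgroup.eq_top_iff' _).mpr fun m => ?_
  induction m using DirectSum.induction_on with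
  | zero => exact zero_mem _
  | of i m =>
    have hsimple := (hρ i).isSimpleSubmodule_range (σ := directSumModule ρ) (DirectSum.of M i)
      (DirectSum.of_injective i) fun r m => directSumModule_of r i m
    exact (le_sSup hsimple : (DirectSum.of M i).range ≤ _) ⟨m, rfl⟩
  | add m n hm hn => exact add_mem hm hn

theorem isFaithful_directSumModule (h : ∀ r, (∀ i m, ρ i r m = 0) → r = 0) :
    IsFaithful (directSumModule ρ) := by
  classical
  refine fun r hr => h r fun i m => DirectSum.of_injective i ?_
  rw [← directSumModule_of, hr, map_zero]

end NonUnitalModules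

section SkewMonoidRing

variable {A : Type u} [Ring A] {G : Type v} [Monoid G] [MulSemiringAction G A]

theorem mem_jacobson_of_single_one_mem_jacobson {a : A}
    (ha : SkewMonoidAlgebra.single 1 a ∈ Ring.jacobson (SkewMonoidAlgebra A G)) :
    a ∈ Ring.jacobson A := by
  rw [← Ideal.jacobson_bot, Ideal.mem_jacobson_iff] at ha ⊢
  intro b
  obtain ⟨z, hz⟩ := ha (SkewMonoidAlgebra.single 1 b)
  refine ⟨z.coeff 1, ?_⟩
  have hcoeff := congrArg (SkewMonoidAlgebra.coeff · 1) ((Submodule.mem_bot _).mp hz)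
  rw [mul_assoc, SkewMonoidAlgebra.single_mul_single, mul_one, one_smul] at hcoeff
  simp only [SkewMonoidAlgebra.coeff_sub, SkewMonoidAlgebra.coeff_add, Finsupp.sub_apply,
    Finsupp.add_apply, SkewMonoidAlgebra.coeff_mul_single_one, SkewMonoidAlgebra.coeff_one,
    Finsupp.single_eq_same, SkewMonoidAlgebra.coeff_zero, Finsupp.zero_apply, one_smul] at hcoeff
  rwa [Submodule.mem_bot, mul_assoc]

theorem mem_jacobson_of_forall_isMaximal {B : Type u} [Ring B] {b : B}
    (h : ∀ J : Ideal B, J.IsMaximal → ∀ m : B ⧸ J, b • m = 0) : b ∈ Ring.jacobson B := by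
  rw [← Ideal.jacobson_bot]
  refine Ideal.mem_sInf.mpr fun {J} hJ => ?_
  have h1 := h J hJ.2 (Submodule.Quotient.mk 1)
  rwa [← Submodule.Quotient.mk_smul, Submodule.Quotient.mk_eq_zero, smul_eq_mul, mul_one] at h1

end SkewMonoidRing

section Induction

variable {X : Type u} [Groupoid.{v} X] [TopologicalSpace X] [TopologicalSpace (Arr X)]
  {𝒪 : GSheafOfRings.{u, v, w} X} {x y : X} {M : Type t} [AddCommGroup M]
  [Module (IsotropyRing 𝒪 x) M]

/-- The class of `l ⊗ m` in `Ind_x(M) = 𝓛_x ⊗_{B_x} M`. -/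
noncomputable def indTmul : Ell 𝒪 x →+ M →+ Ind 𝒪 x M :=
  AddMonoidHom.mk' (fun l => AddMonoidHom.mk'
    (fun m => QuotientAddGroup.mk' (balanced 𝒪 x M) (l ⊗ₜ[ℤ] m)) fun m n => by
      rw [TensorProduct.tmul_add, map_add]) fun l l' => by
    ext m
    simp only [AddMonoidHom.mk'_apply, AddMonoidHom.add_apply, TensorProduct.add_tmul, map_add]

theorem indTmul_rightAct (l : Ell 𝒪 x) (b : IsotropyRing 𝒪 x) (m : M) :
    indTmul (rightAct x b l) m = indTmul l (b • m) :=
  QuotientAddGroup.eq_iff_sub_mem.mpr (AddSubgroup.subset_closure ⟨l, b, m, rfl⟩)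

theorem Ind.induction {p : Ind 𝒪 x M → Prop} (n : Ind 𝒪 x M)
    (tmul : ∀ l m, p (indTmul l m)) (add : ∀ n n', p n → p n' → p (n + n')) : p n := by
  induction n using QuotientAddGroup.induction_on with
  | H z =>
    induction z using TensorProduct.induction_on with
    | zero =>
      have h0 := tmul 0 0
      rwa [map_zero] at h0
    | tmul l m => exact tmul l m
    | add z w hz hw => exact add _ _ hz hw

variable (𝒪 x) in
open Classical in
/-- The projection of `𝓛_x` onto `B_x` that discards the terms `a 1_γ` with `γ` not in the isotropy
group at `x`. -/
noncomputable def isotropyPart : Ell 𝒪 x →+ IsotropyRing 𝒪 x :=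
  AddMonoidHom.mk' (fun l => SkewMonoidAlgebra.ofCoeff
    (DFinsupp.comapDomain (fun δ : End x => (⟨x, δ⟩ : Out x))
      (sigma_mk_injective (β := fun y => x ⟶ y)) l).toFinsupp) fun l l' => by
      rw [← SkewMonoidAlgebra.ofCoeff_add, ← DFinsupp.toFinsupp_add, ← DFinsupp.comapDomain_add]

theorem coeff_isotropyPart (l : Ell 𝒪 x) (δ : End x) :
    (isotropyPart 𝒪 x l).coeff δ = l ⟨x, δ⟩ :=
  rfl

theorem isotropyPart_ellSingle (δ : End x) (a : 𝒪.stalk x) :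
    isotropyPart 𝒪 x (ellSingle δ a) = SkewMonoidAlgebra.single δ a := by
  ext η
  rw [coeff_isotropyPart, SkewMonoidAlgebra.coeff_single]
  by_cases h : η = δ
  · rw [h, Finsupp.single_eq_same]
    exact ellSingle_apply_self (δ : x ⟶ x) a
  · rw [Finsupp.single_eq_of_ne h]
    exact ellSingle_apply_of_ne (δ : x ⟶ x) a fun h' =>
      h (sigma_mk_injective (β := fun y => x ⟶ y) h')

theorem isotropyPart_ellSingle_of_ne (h : y ≠ x) (γ : x ⟶ y) (a : 𝒪.stalk y) :
    isotropyPart 𝒪 x (ellSingle γ a) = 0 := by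
  ext δ
  rw [coeff_isotropyPart, SkewMonoidAlgebra.coeff_zero, Finsupp.zero_apply]
  exact ellSingle_apply_of_ne γ a fun h' => h (congrArg Sigma.fst h').symm

theorem isotropyPart_rightAct (b : IsotropyRing 𝒪 x) (l : Ell 𝒪 x) :
    isotropyPart 𝒪 x (rightAct x b l) = isotropyPart 𝒪 x l * b := by
  induction b using SkewMonoidAlgebra.induction_on with
  | zero => rw [map_zero, AddMonoidHom.zero_apply, map_zero, mul_zero]
  | single δ b =>
    induction l using Ell.induction with
    | @single y γ a =>
      rw [rightAct_single_ellSingle]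
      by_cases h : y = x
      · subst h
        exact (isotropyPart_ellSingle _ _).trans
          ((congrArg (· * _) (isotropyPart_ellSingle γ a)).trans
            SkewMonoidAlgebra.single_mul_single).symm
      · rw [isotropyPart_ellSingle_of_ne h, isotropyPart_ellSingle_of_ne h, zero_mul]
    | add l l' hl hl' => rw [map_add, map_add, hl, hl', map_add, add_mul]
  | add b c hb hc => rw [map_add, AddMonoidHom.add_apply, map_add, hb, hc, mul_add]

variable (𝒪 x M) in
/-- The map `Ind_x(M) → M` that sends `l ⊗ m` to the isotropy part of `l` applied to `m`. -/
noncomputable def indEval : Ind 𝒪 x M →+ M :=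
  QuotientAddGroup.lift (balanced 𝒪 x M)
    (TensorProduct.liftAddHom
      ((smulAddHom (IsotropyRing 𝒪 x) M).comp (isotropyPart 𝒪 x)) fun k l m => by
        rw [map_zsmul, map_zsmul, AddMonoidHom.smul_apply]) <| by
    rw [balanced, AddSubgroup.closure_le]
    rintro _ ⟨l, b, m, rfl⟩
    simp [isotropyPart_rightAct, mul_smul]

theorem indEval_indTmul (l : Ell 𝒪 x) (m : M) :
    indEval 𝒪 x M (indTmul l m) = isotropyPart 𝒪 x l • m :=
  rfl

theorem indTmul_ellSingle_eq (γ₀ γ : x ⟶ y) (a : 𝒪.stalk y) (m : M) :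
    indTmul (ellSingle γ a) m = indTmul (ellSingle γ₀ 1)
      ((SkewMonoidAlgebra.single (show End x from γ ≫ Groupoid.inv γ₀)
        (𝒪.act (Groupoid.inv γ₀) a) : IsotropyRing 𝒪 x) • m) := by
  have hact : 𝒪.act γ₀ (𝒪.act (Groupoid.inv γ₀) a) = a := by
    rw [← 𝒪.act_comp, Groupoid.inv_comp, 𝒪.act_id]
  rw [← indTmul_rightAct, rightAct_single_ellSingle, one_mul, hact, Category.assoc,
    Groupoid.inv_comp, Category.comp_id]

theorem exists_finsupp_sum_eq (γ : ∀ y : {y : X // Nonempty (x ⟶ y)}, x ⟶ y.1)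
    (n : Ind 𝒪 x M) : ∃ c : {y : X // Nonempty (x ⟶ y)} →₀ M,
      (c.sum fun y => indTmul (𝒪 := 𝒪) (ellSingle (γ y) 1)) = n := by
  suffices n ∈ (Finsupp.liftAddHom fun y => indTmul (𝒪 := 𝒪) (M := M) (ellSingle (γ y) 1)).range
    from this
  induction n using Ind.induction with
  | tmul l m =>
    induction l using Ell.induction with
    | @single y δ a =>
      rw [indTmul_ellSingle_eq (γ ⟨y, ⟨δ⟩⟩) δ]
      exact ⟨Finsupp.single ⟨y, ⟨δ⟩⟩ _, Finsupp.liftAddHom_apply_single _ _ _⟩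
    | add l l' hl hl' =>
      rw [map_add]
      exact add_mem hl hl'
  | add n n' hn hn' => exact add_mem hn hn'

/-- The largest submodule `P` of `M` such that all tensors `l ⊗ m` with `m ∈ P` lie in a given
additive subgroup of `Ind_x(M)`. -/
def indContraction (N : AddSubgroup (Ind 𝒪 x M)) : Submodule (IsotropyRing 𝒪 x) M where
  carrier := {m | ∀ l : Ell 𝒪 x, indTmul l m ∈ N}
  add_mem' hm hn l := by
    rw [map_add]
    exact add_mem (hm l) (hn l)
  zero_mem' l := by
    rw [map_zero]
    exact zero_mem N
  smul_mem' b m hm l := by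
    rw [← indTmul_rightAct]
    exact hm _

theorem eq_top_of_indContraction_eq_top {N : AddSubgroup (Ind 𝒪 x M)}
    (h : indContraction N = ⊤) : N = ⊤ := by
  refine N.eq_top_iff'.mpr fun n => ?_
  induction n using Ind.induction with
  | tmul l m =>
    have hm : m ∈ indContraction N := h ▸ Submodule.mem_top
    exact hm l
  | add n n' hn hn' => exact add_mem hn hn'

variable [IsAmpleGroupoid X]

theorem indModule_indTmul (f : Gamma 𝒪) (l : Ell 𝒪 x) (m : M) :
    indModule 𝒪 x M f (indTmul l m) = indTmul (leftAct x f l) m :=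
  rfl

theorem mem_indContraction_of_indTmul_ellSingle_one_mem {N : AddSubgroup (Ind 𝒪 x M)}
    (hN : IsSubmodule (indModule 𝒪 x M) N) {γ : x ⟶ y} {m : M}
    (hm : indTmul (𝒪 := 𝒪) (ellSingle γ 1) m ∈ N) : m ∈ indContraction N := by
  intro l
  induction l using Ell.induction with
  | single δ a =>
    obtain ⟨g, -, hg⟩ := exists_isBisectional_res_eq (𝒪 := 𝒪) (Groupoid.inv γ ≫ δ) a
    have hgm := hN g _ hm
    rwa [indModule_indTmul, leftAct_ellSingle, hg, shift_ellSingle, map_one, mul_one,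
      ← Category.assoc, Groupoid.comp_inv, Category.id_comp] at hgm
  | add l l' hl hl' =>
    rw [map_add]
    exact add_mem hl hl'

theorem indModule_indTmul_ellSingle_of_mem_gammaUnit {e : Gamma 𝒪} (he : e ∈ gammaUnit 𝒪)
    (γ : x ⟶ y) (a : 𝒪.stalk y) (m : M) :
    indModule 𝒪 x M e (indTmul (ellSingle γ a) m) =
      indTmul (ellSingle γ (unitValue e.1 y * a)) m := by
  rw [indModule_indTmul, leftAct_ellSingle_of_mem_gammaUnitSubgroup he]

variable (𝒪) in
theorem exists_separating {S : Set X} (hS : S.Finite) (hy : y ∉ S) :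
    ∃ e ∈ gammaUnit 𝒪, unitValue e.1 y = 1 ∧ ∀ z ∈ S, unitValue e.1 z = 0 := by
  have : T2Space X := IsAmpleGroupoid.t2
  have hN : IsOpen ((fun γ : Arr X => γ.right) ⁻¹' Sᶜ) :=
    hS.isClosed.isOpen_compl.preimage continuous_range
  obtain ⟨W, e, he, -, hWN, hsupp, hey⟩ :=
    exists_mem_gammaUnit_unitValue_eq (𝒪 := 𝒪) (y := y) hN hy 1
  exact ⟨e, he, hey, fun z hz => hsupp.2 _ fun hzW => (hWN hzW).1 hz⟩

theorem indTmul_mem_of_sum_mem {N : AddSubgroup (Ind 𝒪 x M)}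
    (hN : IsSubmodule (indModule 𝒪 x M) N)
    {γ : ∀ y : {y : X // Nonempty (x ⟶ y)}, x ⟶ y.1} {c : {y : X // Nonempty (x ⟶ y)} →₀ M}
    (hc : (c.sum fun y => indTmul (𝒪 := 𝒪) (ellSingle (γ y) 1)) ∈ N)
    (y : {y : X // Nonempty (x ⟶ y)}) : indTmul (𝒪 := 𝒪) (ellSingle (γ y) 1) (c y) ∈ N := by
  classical
  obtain ⟨e, he, hey, hez⟩ := exists_separating 𝒪 (y := y.1)
    (((c.support.erase y).finite_toSet).image Subtype.val) (by
      rintro ⟨z, hz, hzy⟩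
      exact Finset.ne_of_mem_erase hz (Subtype.ext hzy))
  have hsum : indModule 𝒪 x M e (c.sum fun y => indTmul (ellSingle (γ y) 1)) =
      indTmul (ellSingle (γ y) 1) (c y) := by
    rw [Finsupp.sum, map_sum, Finset.sum_eq_single y]
    · rw [indModule_indTmul_ellSingle_of_mem_gammaUnit he, hey, mul_one]
    · intro z hz hzy
      rw [indModule_indTmul_ellSingle_of_mem_gammaUnit he,
        hez z ⟨z, Finset.mem_erase.mpr ⟨hzy, hz⟩, rfl⟩, zero_mul, map_zero, map_zero,
        AddMonoidHom.zero_apply]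
    · intro hy
      rw [Finsupp.notMem_support_iff.mp hy, map_zero, map_zero]
  exact hsum ▸ hN e _ hc

theorem indContraction_ne_bot {N : AddSubgroup (Ind 𝒪 x M)}
    (hN : IsSubmodule (indModule 𝒪 x M) N) (hbot : N ≠ ⊥) : indContraction N ≠ ⊥ := by
  intro h
  refine hbot ((AddSubgroup.eq_bot_iff_forall N).mpr fun n hn => ?_)
  let γ (y : {y : X // Nonempty (x ⟶ y)}) : x ⟶ y.1 := y.2.some
  obtain ⟨c, rfl⟩ := exists_finsupp_sum_eq γ n
  refine Finset.sum_eq_zero fun y _ => ?_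
  have hcy := mem_indContraction_of_indTmul_ellSingle_one_mem hN (indTmul_mem_of_sum_mem hN hn y)
  rw [h, Submodule.mem_bot] at hcy
  rw [hcy]
  exact map_zero _

theorem single_one_unitValue_smul_eq_zero {f : Gamma 𝒪} (hf : f ∈ gammaUnit 𝒪)
    (h : ∀ n, indModule 𝒪 x M f n = 0) (m : M) :
    (SkewMonoidAlgebra.single 1 (unitValue f.1 x) : IsotropyRing 𝒪 x) • m = 0 := by
  have hm := congrArg (indEval 𝒪 x M) (h (indTmul (ellSingle (𝟙 x) 1) m))
  rw [indModule_indTmul_ellSingle_of_mem_gammaUnit hf, mul_one, indEval_indTmul, map_zero] at hm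
  exact (congrArg (· • m) (isotropyPart_ellSingle 1 _)).symm.trans hm

variable (𝒪 x M) in
theorem isSimple_indModule [IsSimpleModule (IsotropyRing 𝒪 x) M] :
    IsSimple (indModule 𝒪 x M) := by
  refine ⟨fun _ _ _ => AddSubgroup.mem_top _, ?_, fun N hN _ =>
    or_iff_not_imp_left.mpr fun hbot => eq_top_of_indContraction_eq_top <|
      (eq_bot_or_eq_top _).resolve_left (indContraction_ne_bot hN hbot)⟩
  have : Nontrivial M := IsSimpleModule.nontrivial (IsotropyRing 𝒪 x) M
  obtain ⟨m, hm⟩ := exists_ne (0 : M)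
  obtain ⟨e, he, hex, -⟩ := exists_separating 𝒪 Set.finite_empty (Set.notMem_empty x)
  by_contra! hzero
  have hem := single_one_unitValue_smul_eq_zero he (fun n => hzero e n (AddSubgroup.mem_top n)) m
  rw [hex] at hem
  exact hm ((one_smul (IsotropyRing 𝒪 x) m).symm.trans hem)

end Induction

section Main

variable {X : Type u} [Groupoid.{v} X] [TopologicalSpace X] [TopologicalSpace (Arr X)]
  {𝒪 : GSheafOfRings.{u, v, w} X}

theorem GSheafOfRings.IsSheafOfFields.jacobson_stalk_eq_bot (h𝒪 : 𝒪.IsSheafOfFields) (x : X) :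
    Ring.jacobson (𝒪.stalk x) = ⊥ :=
  letI := (h𝒪 x).toField
  IsSemisimpleRing.jacobson_eq_bot (𝒪.stalk x)

theorem GSheafOfRings.IsSheafOfFields.eq_zero_of_single_one_smul_eq_zero (h𝒪 : 𝒪.IsSheafOfFields)
    {x : X} (M : Type t) [AddCommGroup M] [Module (IsotropyRing 𝒪 x) M] [Nontrivial M]
    {a : 𝒪.stalk x} (ha : ∀ m : M, (SkewMonoidAlgebra.single 1 a : IsotropyRing 𝒪 x) • m = 0) :
    a = 0 := by
  by_contra hne
  obtain ⟨b, hab⟩ := (h𝒪 x).mul_inv_cancel hne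
  have hba :
      (SkewMonoidAlgebra.single 1 b * SkewMonoidAlgebra.single 1 a : IsotropyRing 𝒪 x) = 1 := by
    rw [SkewMonoidAlgebra.single_mul_single, one_smul, mul_one, (h𝒪 x).mul_comm, hab]
    rfl
  obtain ⟨m, hm⟩ := exists_ne (0 : M)
  exact hm (by rw [← one_smul (IsotropyRing 𝒪 x) m, ← hba, mul_smul, ha, smul_zero])

variable [IsAmpleGroupoid X]

theorem eq_zero_of_forall_indModule_eq_zero (hmax : IsMaximalCommutative (gammaUnit 𝒪))
    {ι : X → Type*} (M : ∀ x, ι x → Type t) [∀ x i, AddCommGroup (M x i)]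
    [∀ x i, Module (IsotropyRing 𝒪 x) (M x i)]
    (hM : ∀ x (a : 𝒪.stalk x),
      (∀ i (m : M x i), (SkewMonoidAlgebra.single 1 a : IsotropyRing 𝒪 x) • m = 0) → a = 0)
    {f : Gamma 𝒪} (hf : ∀ x i n, indModule 𝒪 x (M x i) f n = 0) : f = 0 := by
  let I : TwoSidedIdeal (Gamma 𝒪) := ⨅ (x) (i), TwoSidedIdeal.ker (indModule 𝒪 x (M x i))
  have hI (g : Gamma 𝒪) : g ∈ I ↔ ∀ x i n, indModule 𝒪 x (M x i) g n = 0 := by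
    simp only [I, TwoSidedIdeal.mem_iInf, TwoSidedIdeal.mem_ker, DFunLike.ext_iff]
    rfl
  have hbot : I = ⊥ := eq_bot_of_forall_mem_gammaUnit_eq_zero hmax fun g hg hgu =>
    eq_zero_of_unitValue_eq_zero hgu fun x => hM x _ fun i m =>
      single_one_unitValue_smul_eq_zero hgu ((hI g).mp hg x i) m
  exact (TwoSidedIdeal.mem_bot _).mp (hbot ▸ (hI f).mpr hf)

theorem isSemiprimitive_gamma (hmax : IsMaximalCommutative (gammaUnit 𝒪))
    (h𝒪 : ∀ x, Ring.jacobson (𝒪.stalk x) = ⊥) : IsSemiprimitive (Gamma 𝒪) := by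
  have hsimple (p : Σ x, {J : Ideal (IsotropyRing 𝒪 x) // J.IsMaximal}) :
      IsSimple (indModule 𝒪 p.1 (IsotropyRing 𝒪 p.1 ⧸ p.2.1)) :=
    have := isSimpleModule_iff_isCoatom.mpr p.2.2.out
    isSimple_indModule 𝒪 p.1 _
  refine isSemiprimitive_of_forall_isSimple hsimple fun f hf =>
    eq_zero_of_forall_indModule_eq_zero hmax
      (fun x (J : {J : Ideal (IsotropyRing 𝒪 x) // J.IsMaximal}) => IsotropyRing 𝒪 x ⧸ J.1)
      (fun x a ha => ?_) fun x J => hf ⟨x, J⟩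
  rw [← Submodule.mem_bot (𝒪.stalk x), ← h𝒪 x]
  exact mem_jacobson_of_single_one_mem_jacobson
    (mem_jacobson_of_forall_isMaximal fun J hJ => ha ⟨J, hJ⟩)

theorem isFaithful_directSumModule_indModule (hmax : IsMaximalCommutative (gammaUnit 𝒪))
    {M : X → Type t} [∀ x, AddCommGroup (M x)] [∀ x, Module (IsotropyRing 𝒪 x) (M x)]
    (hM : ∀ x (a : 𝒪.stalk x),
      (∀ m : M x, (SkewMonoidAlgebra.single 1 a : IsotropyRing 𝒪 x) • m = 0) → a = 0) :
    IsFaithful (directSumModule fun x => indModule 𝒪 x (M x)) :=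
  isFaithful_directSumModule fun _ hf =>
    eq_zero_of_forall_indModule_eq_zero hmax (fun x (_ : Unit) => M x)
      (fun x a ha => hM x a (ha ())) fun x _ => hf x

end Main

end SheafAlgebra

theorem mainTheorem9_general {X : Type u} [Groupoid.{v} X] [TopologicalSpace X]
    [TopologicalSpace (SheafAlgebra.Arr X)] [SheafAlgebra.IsAmpleGroupoid X]
    (𝒪 : SheafAlgebra.GSheafOfRings.{u, v, w} X)
    (hmax : SheafAlgebra.IsMaximalCommutative (SheafAlgebra.gammaUnit 𝒪)) :
    ((∀ x, Ring.jacobson (𝒪.stalk x) = ⊥) →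
        SheafAlgebra.IsSemiprimitive (SheafAlgebra.Gamma 𝒪)) ∧
      ∀ (M : X → Type t) [∀ x, AddCommGroup (M x)]
        [∀ x, Module (SheafAlgebra.IsotropyRing 𝒪 x) (M x)]
        [∀ x, IsSimpleModule (SheafAlgebra.IsotropyRing 𝒪 x) (M x)],
        SheafAlgebra.IsSemisimple
            (SheafAlgebra.directSumModule fun x => SheafAlgebra.indModule 𝒪 x (M x)) ∧
          ((∀ x (a : 𝒪.stalk x), (∀ m : M x,
              (SkewMonoidAlgebra.single 1 a : SheafAlgebra.IsotropyRing 𝒪 x) • m = 0) → a = 0) →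
            SheafAlgebra.IsFaithful
              (SheafAlgebra.directSumModule fun x => SheafAlgebra.indModule 𝒪 x (M x))) :=
  ⟨SheafAlgebra.isSemiprimitive_gamma hmax, fun M _ _ _ =>
    ⟨SheafAlgebra.isSemisimple_directSumModule fun x => SheafAlgebra.isSimple_indModule 𝒪 x (M x),
      SheafAlgebra.isFaithful_directSumModule_indModule hmax⟩⟩

theorem mainTheorem9 {X : Type u} [Groupoid.{v} X] [TopologicalSpace X]
    [TopologicalSpace (SheafAlgebra.Arr X)] [SheafAlgebra.IsAmpleGroupoid X]
    (𝒪 : SheafAlgebra.GSheafOfRings.{u, v, w} X) (h𝒪 : 𝒪.IsSheafOfFields)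
    (hmax : SheafAlgebra.IsMaximalCommutative (SheafAlgebra.gammaUnit 𝒪)) :
    SheafAlgebra.IsSemiprimitive (SheafAlgebra.Gamma 𝒪) ∧
      ∀ (M : X → Type t) [∀ x, AddCommGroup (M x)]
        [∀ x, Module (SheafAlgebra.IsotropyRing 𝒪 x) (M x)]
        [∀ x, IsSimpleModule (SheafAlgebra.IsotropyRing 𝒪 x) (M x)],
        SheafAlgebra.IsSemisimple
            (SheafAlgebra.directSumModule fun x => SheafAlgebra.indModule 𝒪 x (M x)) ∧
          SheafAlgebra.IsFaithful
            (SheafAlgebra.directSumModule fun x => SheafAlgebra.indModule 𝒪 x (M x)) := by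
  obtain ⟨hsemiprimitive, hsum⟩ := mainTheorem9_general 𝒪 hmax
  exact ⟨hsemiprimitive h𝒪.jacobson_stalk_eq_bot, fun M _ _ _ =>
    (hsum M).imp_right fun hfaithful => hfaithful fun x a ha =>
      have := IsSimpleModule.nontrivial (SheafAlgebra.IsotropyRing 𝒪 x) (M x)
      h𝒪.eq_zero_of_single_one_smul_eq_zero (M x) ha⟩
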